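/- Consider the Calogero--Moser derivative NLS $$ i\partial_t u+\partial_{xx}u+(D+|D|)(|u|^2)\,u=0,\qquad D=-i\partial_x, \tag{CM} $$ on $J\times\mathbb R$, where $J\subset\mathbb R$ is an interval with more than one point. Solutions are understood as follows: $u(t)\in H^1(\mathbb R)$ for all $t\in J$, and for every $t \in J$ the equation holds in the sense of distributions in $x$. Let $H^1_+(\mathbb R)=\{f\in H^1(\mathbb R):\operatorname{supp}\hat f\subset[0,\infty)\}$, $M(f)=\int_{\mathbb R}|f|^2\,dx$ and $\mathcal R(x)=\frac{\sqrt2}{x+i}$. A traveling solitary wave is a solution of (CM) of the form $$u(t,x)=e^{i\omega t}R_{v,\omega}(x-vt),\qquad v,\omega\in\mathbb R,\quad R_{v,\omega}\in H^1(\mathbb R)\setminus\{0\}.$$ (i) For every traveling solitary wave, $$\omega=\frac{v^2}{4},\qquad R_{v,\omega}(x)=e^{\frac i2vx}e^{i\theta}\lambda^{1/2}\mathcal R(\lambda x+y)$$ for some $\theta\in[0,2\pi)$, $\lambda>0$, $y\in\mathbb R$. Moreover, $R_{v,\omega}\in H^1_+(\mathbb R)$ if and only if $v\ge0$, and $M(u(t))=M(\mathcal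 R)=2\pi$ for all $t\in J$. (ii) Every traveling solitary wave with $u(t)\in H^1_+(\mathbb R)$ for all $t\in J$ is of the form $$u(t,x)=e^{i\theta+i\eta x-i\eta^2t}\lambda^{1/2}\mathcal R(\lambda(x-2\eta t)+y)$$ for some $\theta\in[0,2\pi)$, $y\in\mathbb R$, $\lambda>0$ and $\eta\ge0$. In particular $M(u(t))=M(\mathcal R)=2\pi$ for all $t \in J$. -/

import Mathlib

open MeasureTheory Set
open scoped FourierTransform SchwartzMap

noncomputable section

namespace CMDNLS

/-- `f` (a function on the line, understood up to null sets) belongs to the Sobolev space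
`H¹(ℝ)`: it is square integrable, and the tempered distribution it defines is a Sobolev function
of order `1` based on `L²`. -/
def MemH1 (f : ℝ → ℂ) : Prop :=
  ∃ hf : MemLp f 2 volume,
    TemperedDistribution.MemSobolev 1 2
      (Lp.toTemperedDistribution (hf.toLp f) : 𝓢'(ℝ, ℂ))

/-- `f` belongs to the Hardy-Sobolev space `H¹₊(ℝ)`: it is in `H¹(ℝ)`, and its (`L²`) Fourier
transform vanishes almost everywhere on the negative half-line, that is, has its support
in `[0, ∞)`. -/
def MemH1Plus (f : ℝ → ℂ) : Prop :=
  MemH1 f ∧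
    ∃ hf : MemLp f 2 volume,
      ∀ᵐ ξ : ℝ, ξ < 0 → (𝓕 (hf.toLp f : Lp ℂ 2 (volume : Measure ℝ)) : Lp ℂ 2 volume) ξ = 0

open scoped Classical in
/-- The (possibly unbounded) Fourier multiplier `m` on `L²(ℝ)`: its domain consists of those
`f ∈ L²` for which `m · 𝓕 f ∈ L²`, and there the result is `𝓕⁻¹ (m · 𝓕 f)`. Outside the domain
the value is `0` by convention. -/
def multiplier (m : ℝ → ℂ) (f : Lp ℂ 2 (volume : Measure ℝ)) : Lp ℂ 2 (volume : Measure ℝ) :=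
  if h : MemLp (fun ξ : ℝ => m ξ * (𝓕 f : Lp ℂ 2 (volume : Measure ℝ)) ξ) 2 volume then
    𝓕⁻ (h.toLp _ : Lp ℂ 2 (volume : Measure ℝ))
  else 0

open scoped Classical in
/-- The operator `D + |D|`, where `D = -i ∂ₓ`, with domain containing `H¹(ℝ)`. As Mathlib's Fourier
transform is `∫ exp (-2 π i x ξ) f x dx`, the symbol of `D` is `2 π ξ`, and the symbol of `|D|` is
its absolute value. (Every function `|u|²` with `u ∈ H¹(ℝ)` is in `H¹(ℝ)`, hence in the domain.) -/
def DAddAbsD (f : ℝ → ℂ) : Lp ℂ 2 (volume : Measure ℝ) :=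
  if hf : MemLp f 2 volume then
    multiplier (fun ξ : ℝ => ((2 * Real.pi * ξ + |2 * Real.pi * ξ| : ℝ) : ℂ)) (hf.toLp f)
  else 0

/-- `u` is an `H¹` solution on the time interval `J` of the Calogero--Moser derivative NLS
`i ∂ₜ u + ∂ₓₓ u + (D + |D|)(|u|²) u = 0`:
one has `u t ∈ H¹(ℝ)` for all `t ∈ J`, and the equation, in the form
`∂ₜ u = i ∂ₓₓ u + i (D + |D|)(|u|²) u`, holds at every time of `J` in the sense of distributions
in `x` (with the one-sided time derivative at those end points that belong to `J`). Continuity of `t ↦ u t` into `H¹(ℝ)` is not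
required, which only makes the notion weaker; it is automatic for waves
`exp (i ω t) R(x - v t)` with `R ∈ H¹(ℝ)`. -/
structure IsSolution (J : Set ℝ) (u : ℝ → ℝ → ℂ) : Prop where
  memH1 : ∀ t ∈ J, MemH1 (u t)
  equation : ∀ t ∈ J, ∀ φ : ℝ → ℂ, ContDiff ℝ (⊤ : ℕ∞) φ → HasCompactSupport φ →
    HasDerivWithinAt (fun s : ℝ => ∫ x : ℝ, u s x * φ x)
      (Complex.I * (∫ x : ℝ, u t x * iteratedDeriv 2 φ x) +
        Complex.I * ∫ x : ℝ, DAddAbsD (fun z : ℝ => ((‖u t z‖ ^ 2 : ℝ) : ℂ)) x * u t x * φ x)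
      J t

/-- `u` is a traveling solitary wave (with finite energy) on the time interval `J`, with velocity
`v`, frequency `ω` and profile `R ∈ H¹(ℝ) \ {0}`: it solves the equation and
`u(t, x) = exp (i ω t) R(x - v t)`. -/
structure IsTravelingWave (J : Set ℝ) (v ω : ℝ) (R : ℝ → ℂ) (u : ℝ → ℝ → ℂ) : Prop where
  profile_memH1 : MemH1 R
  profile_ne_zero : ¬ R =ᵐ[volume] 0
  form : ∀ t ∈ J, u t =ᵐ[volume] fun x : ℝ => Complex.exp (Complex.I * ω * t) * R (x - v * t)
  solution : IsSolution J u

/-- The ground state `𝓡(x) = √2 / (x + i)`. -/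
def groundState (x : ℝ) : ℂ := (Real.sqrt 2 : ℂ) / ((x : ℂ) + Complex.I)

/-- The `L²`-mass `M(f) = ∫ |f|² dx`. -/
def mass (f : ℝ → ℂ) : ℝ := ∫ x : ℝ, ‖f x‖ ^ 2

end CMDNLS

end

/-! At a fixed time, remove the velocity by the modulation `Q = exp(-ivx/2) u(t)`. With `ρ = |Q|²`
and `F = 2 Π₊ ρ` (so `F + F̄ = 2ρ` and `(D + |D|) ρ = -i F'`), the wave equation becomes `Q'' = μ Q
+ i F' Q`, where `μ = ω - v²/4`. Elliptic regularity makes weak solutions classical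
(`exists_isProfile`).

The heart of the proof is that the energy `∫ |Q' - (i/2) F Q|²` vanishes (`IsProfile.deriv_eq`). Its
density is a linear combination of four quantities with zero integral and of their conjugates: the
derivatives `(Q' Q̄)'` and `(F ρ)'`, the cube `F³` of a Hardy function, and the momentum flux `S =
|Q'|² - ρ³/3 - μ ρ`. For the flux, the current law `Q̄ Q' - Q Q̄' = i ρ²` gives `S' = (i/4)(F'² -
conj(F'²))`. At positive frequencies only `F'²` contributes, and its transform is `O(ξ³)`; dividing
by `ξ` gives `Ŝ(ξ) = O(ξ²)`, hence `∫ S = Ŝ(0) = 0`.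

The resulting first order equation `Q' = (i/2) F Q` shows that `F' - (i/2) F²` has zero real part.
Being a Hardy function, it vanishes, so `F` solves the Riccati equation `F' = (i/2) F²`
(`IsProfile.hardyDeriv_eq`). Substituting back forces `μ = 0`, and explicit integration gives `Q = κ
/ (x + c)` with `Im c > 0` and `|κ|² = 2 Im c`, a rescaled and translated ground state. The
frequency support of the modulated wave is `[v/4π, ∞)`, whence the criterion `v ≥ 0`. -/

namespace CMDNLS

open Filter Topology
open scoped Convolution

/-! ### Primitives of locally integrable functions -/

/-- `G` is a primitive (indefinite integral) of the locally integrable function `g`. -/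
structure IsPrimitive (G g : ℝ → ℂ) : Prop where
  locallyIntegrable : LocallyIntegrable g volume
  integral_eq : ∀ a b : ℝ, ∫ x in a..b, g x = G b - G a

lemma _root_.MeasureTheory.LocallyIntegrable.intervalIntegrable_real {g : ℝ → ℂ}
    (hg : LocallyIntegrable g volume) (a b : ℝ) : IntervalIntegrable g volume a b :=
  (hg.integrableOn_isCompact isCompact_uIcc).intervalIntegrable

namespace IsPrimitive

variable {G g H h : ℝ → ℂ}

lemma intervalIntegrable (hG : IsPrimitive G g) (a b : ℝ) : IntervalIntegrable g volume a b :=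
  hG.locallyIntegrable.intervalIntegrable_real a b

lemma eq_add (hG : IsPrimitive G g) (a : ℝ) : G = fun x => G a + ∫ t in a..x, g t := by
  ext x
  rw [hG.integral_eq a x]
  ring

lemma continuous (hG : IsPrimitive G g) : Continuous G := by
  rw [hG.eq_add 0]
  exact continuous_const.add (intervalIntegral.continuous_primitive hG.intervalIntegrable 0)

lemma ae_hasDerivAt (hG : IsPrimitive G g) : ∀ᵐ x, HasDerivAt G (g x) x := by
  filter_upwards [LocallyIntegrable.ae_hasDerivAt_integral hG.locallyIntegrable] with x hx
  rw [hG.eq_add 0]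
  exact (hx 0).const_add _

lemma absolutelyContinuousOnInterval (hG : IsPrimitive G g) (a b : ℝ) :
    AbsolutelyContinuousOnInterval G a b := by
  have h := (hG.intervalIntegrable a b).norm.absolutelyContinuousOnInterval_intervalIntegral
    (c := a) left_mem_uIcc
  refine squeeze_zero (fun t => Finset.sum_nonneg fun i _ => dist_nonneg)
    (fun t => Finset.sum_le_sum fun i _ => ?_) h
  have hn : ∀ c d : ℝ, IntervalIntegrable (fun x => ‖g x‖) volume c d :=
    fun c d => (hG.intervalIntegrable c d).norm
  rw [Real.dist_eq, intervalIntegral.integral_interval_sub_left (hn _ _) (hn _ _), dist_eq_norm,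
    ← hG.integral_eq]
  exact intervalIntegral.norm_integral_le_abs_integral_norm

lemma of_hasDerivAt (hG : ∀ x, HasDerivAt G (g x) x) (hg : Continuous g) : IsPrimitive G g :=
  ⟨hg.locallyIntegrable, fun a b => intervalIntegral.integral_eq_sub_of_hasDerivAt
    (fun x _ => hG x) (hg.intervalIntegrable a b)⟩

lemma hasDerivAt (hG : IsPrimitive G g) (hg : Continuous g) (x : ℝ) : HasDerivAt G (g x) x := by
  rw [hG.eq_add 0]
  exact (intervalIntegral.integral_hasDerivAt_right (hg.intervalIntegrable _ _)
    (hg.stronglyMeasurableAtFilter _ _) hg.continuousAt).const_add _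

lemma congr_ae (hG : IsPrimitive G g) (hgh : g =ᵐ[volume] h) : IsPrimitive G h := by
  refine ⟨hG.locallyIntegrable.congr hgh, fun a b => ?_⟩
  rw [← hG.integral_eq]
  exact intervalIntegral.integral_congr_ae (hgh.mono fun x hx _ => hx.symm)

lemma add (hG : IsPrimitive G g) (hH : IsPrimitive H h) :
    IsPrimitive (fun x => G x + H x) (fun x => g x + h x) := by
  refine ⟨hG.locallyIntegrable.add hH.locallyIntegrable, fun a b => ?_⟩
  rw [intervalIntegral.integral_add (hG.intervalIntegrable a b) (hH.intervalIntegrable a b),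
    hG.integral_eq, hH.integral_eq]
  ring

lemma star (hG : IsPrimitive G g) :
    IsPrimitive (fun x => starRingEnd ℂ (G x)) (fun x => starRingEnd ℂ (g x)) := by
  refine ⟨fun x => ?_, fun a b => ?_⟩
  · obtain ⟨s, hs, hi⟩ := hG.locallyIntegrable x
    exact ⟨s, hs, Complex.conjCLE.toContinuousLinearMap.integrable_comp hi⟩
  · rw [← map_sub, ← hG.integral_eq, intervalIntegral, intervalIntegral, map_sub,
      integral_conj, integral_conj]

/-- The Leibniz rule. -/
lemma mul (hG : IsPrimitive G g) (hH : IsPrimitive H h) :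
    IsPrimitive (fun x => G x * H x) (fun x => g x * H x + G x * h x) := by
  have hL : LocallyIntegrable (fun x => g x * H x + G x * h x) volume := by
    refine LocallyIntegrable.add ?_ ?_
    · have := hG.locallyIntegrable.locallyIntegrableOn univ |>.mul_continuousOn
        hH.continuous.continuousOn isOpen_univ.isLocallyClosed
      exact locallyIntegrableOn_univ.1 this
    · have := hH.locallyIntegrable.locallyIntegrableOn univ |>.continuousOn_mul
        hG.continuous.continuousOn isOpen_univ.isLocallyClosed
      exact locallyIntegrableOn_univ.1 this
  refine ⟨hL, fun a b => ?_⟩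
  have hP : IsPrimitive (fun x => ∫ t in a..x, (g t * H t + G t * h t))
      (fun x => g x * H x + G x * h x) :=
    ⟨hL, fun c d => by
      rw [intervalIntegral.integral_interval_sub_left (hL.intervalIntegrable_real _ _)
        (hL.intervalIntegrable_real _ _)]⟩
  -- The product is differentiable only almost everywhere; absolute continuity is what makes its
  -- difference from the integral constant.
  have hAC := ((hG.absolutelyContinuousOnInterval a b).smul
    (hH.absolutelyContinuousOnInterval a b)).sub (hP.absolutelyContinuousOnInterval a b)
  obtain ⟨C, hC⟩ := hAC.const_of_ae_hasDerivAt_zero (by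
    filter_upwards [hG.ae_hasDerivAt, hH.ae_hasDerivAt, hP.ae_hasDerivAt] with x h1 h2 h3 _
    have := (h1.mul h2).sub h3
    rw [sub_self] at this
    exact this)
  have ha := hC a left_mem_uIcc
  have hb := hC b right_mem_uIcc
  simp only [Pi.sub_apply, smul_eq_mul, Pi.mul_apply, intervalIntegral.integral_same] at ha hb
  linear_combination ha - hb

/-- Integrability of `g` gives a limit, and integrability of `G` forces it to be zero because a
half-line has infinite measure. -/
lemma tendsto_atTop (hG : IsPrimitive G g) (hGi : Integrable G) (hg : Integrable g) :
    Tendsto G atTop (𝓝 0) := by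
  have h1 : Tendsto G atTop (𝓝 (G 0 + ∫ t in Ioi (0 : ℝ), g t)) := by
    rw [hG.eq_add 0]
    simp only [intervalIntegral.integral_same, add_zero]
    exact tendsto_const_nhds.add
      (intervalIntegral_tendsto_integral_Ioi 0 hg.integrableOn tendsto_id)
  have h0 := (hGi.integrableAtFilter atTop).eq_zero_of_tendsto (fun s hs => by
    rcases mem_atTop_sets.1 hs with ⟨b, hb⟩
    rw [← top_le_iff, ← Real.volume_Ici (a := b)]
    exact measure_mono hb) h1
  rwa [h0] at h1

lemma tendsto_atBot (hG : IsPrimitive G g) (hGi : Integrable G) (hg : Integrable g) :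
    Tendsto G atBot (𝓝 0) := by
  have h1 : Tendsto G atBot (𝓝 (G 0 - ∫ t in Iic (0 : ℝ), g t)) := by
    have : G = fun x => G 0 - ∫ t in x..0, g t := by
      ext x
      rw [hG.integral_eq x 0]
      ring
    rw [this]
    simp only [intervalIntegral.integral_same, sub_zero]
    exact tendsto_const_nhds.sub
      (intervalIntegral_tendsto_integral_Iic 0 hg.integrableOn tendsto_id)
  have h0 := (hGi.integrableAtFilter atBot).eq_zero_of_tendsto (fun s hs => by
    rcases mem_atBot_sets.1 hs with ⟨b, hb⟩
    rw [← top_le_iff, ← Real.volume_Iic (a := b)]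
    exact measure_mono hb) h1
  rwa [h0] at h1

/-- The integral of the derivative of an integrable function vanishes. -/
lemma integral_eq_zero (hG : IsPrimitive G g) (hGi : Integrable G) (hg : Integrable g) :
    ∫ x, g x = 0 := by
  have h1 := intervalIntegral_tendsto_integral hg tendsto_neg_atTop_atBot tendsto_id
  have h2 : Tendsto (fun x : ℝ => ∫ t in (-x)..id x, g t) atTop (𝓝 (0 - 0)) := by
    simp only [hG.integral_eq, id]
    exact (hG.tendsto_atTop hGi hg).sub
      ((hG.tendsto_atBot hGi hg).comp tendsto_neg_atTop_atBot)
  simpa using tendsto_nhds_unique h1 h2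

/-- A primitive of an integrable function is bounded. -/
lemma exists_norm_le (hG : IsPrimitive G g) (hg : Integrable g) : ∃ C, ∀ x, ‖G x‖ ≤ C := by
  refine ⟨‖G 0‖ + ∫ t, ‖g t‖, fun x => ?_⟩
  rw [hG.eq_add 0]
  simp only [intervalIntegral.integral_same, add_zero]
  refine (norm_add_le _ _).trans (add_le_add_right ?_ _)
  refine (intervalIntegral.norm_integral_le_integral_norm_uIoc).trans ?_
  exact setIntegral_le_integral hg.norm (ae_of_all _ fun _ => norm_nonneg _)

end IsPrimitive

/-! ### Weak derivatives and the lemma of du Bois-Reymond -/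

/-- `g` is the weak derivative of `f`. -/
def IsWeakDeriv (f g : ℝ → ℂ) : Prop :=
  ∀ φ : ℝ → ℂ, ContDiff ℝ (⊤ : ℕ∞) φ → HasCompactSupport φ →
    ∫ x, f x * deriv φ x = -∫ x, g x * φ x

lemma contDiff_deriv {φ : ℝ → ℂ} (hφ : ContDiff ℝ (⊤ : ℕ∞) φ) :
    ContDiff ℝ (⊤ : ℕ∞) (deriv φ) :=
  (contDiff_infty_iff_deriv.1 hφ).2

lemma hasDerivAt_of_contDiff {φ : ℝ → ℂ} (hφ : ContDiff ℝ (⊤ : ℕ∞) φ) (x : ℝ) :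
    HasDerivAt φ (deriv φ x) x :=
  ((contDiff_infty_iff_deriv.1 hφ).1 x).hasDerivAt

lemma integrable_mul_of_compactSupport {f φ : ℝ → ℂ} (hf : LocallyIntegrable f volume)
    (hφ : Continuous φ) (hs : HasCompactSupport φ) : Integrable (fun x => f x * φ x) := by
  have := hf.integrable_smul_left_of_hasCompactSupport hφ hs
  simpa only [smul_eq_mul, mul_comm] using this

lemma IsPrimitive.isWeakDeriv {G g : ℝ → ℂ} (hG : IsPrimitive G g) : IsWeakDeriv G g := by
  intro φ hφ hs
  have hd := contDiff_deriv hφ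
  have hP := hG.mul (IsPrimitive.of_hasDerivAt (hasDerivAt_of_contDiff hφ) hd.continuous)
  have i1 := integrable_mul_of_compactSupport hG.locallyIntegrable hφ.continuous hs
  have i2 := integrable_mul_of_compactSupport hG.continuous.locallyIntegrable hd.continuous
    hs.deriv
  have := hP.integral_eq_zero (integrable_mul_of_compactSupport
    hG.continuous.locallyIntegrable hφ.continuous hs) (i1.add i2)
  rw [integral_add i1 i2] at this
  linear_combination this

/-- The integral over `Iic x` is zero to the left of the support and equals the total integral,
again zero, to the right of it. -/
lemma exists_primitive_of_integral_eq_zero {χ : ℝ → ℂ} (hχ : ContDiff ℝ (⊤ : ℕ∞) χ)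
    (hs : HasCompactSupport χ) (h0 : ∫ x, χ x = 0) :
    ∃ φ : ℝ → ℂ, ContDiff ℝ (⊤ : ℕ∞) φ ∧ HasCompactSupport φ ∧ deriv φ = χ := by
  obtain ⟨R, hR⟩ := hs.isCompact.isBounded.subset_closedBall (0 : ℝ)
  have hz : ∀ x, R < |x| → χ x = 0 := fun x hx => by
    by_contra h
    have := hR (subset_tsupport _ h)
    rw [mem_closedBall_zero_iff, Real.norm_eq_abs] at this
    linarith
  have hi : ∀ a b, IntervalIntegrable χ volume a b :=
    fun a b => hχ.continuous.intervalIntegrable a b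
  have hint : Integrable χ := hχ.continuous.integrable_of_hasCompactSupport hs
  have hd : ∀ x, HasDerivAt (fun x => ∫ t in Iic x, χ t) (χ x) x := by
    intro x
    have e : (fun x => ∫ t in Iic x, χ t) =
        fun x => (∫ t in Iic (0 : ℝ), χ t) + ∫ t in (0 : ℝ)..x, χ t := by
      ext y
      rw [← intervalIntegral.integral_Iic_sub_Iic hint.integrableOn hint.integrableOn]
      ring
    rw [e]
    exact (intervalIntegral.integral_hasDerivAt_right (hi _ _)
      (hχ.continuous.stronglyMeasurableAtFilter _ _) hχ.continuous.continuousAt).const_add _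
  have hdv : deriv (fun x => ∫ t in Iic x, χ t) = χ := funext fun x => (hd x).deriv
  refine ⟨fun x => ∫ t in Iic x, χ t, ?_, ?_, hdv⟩
  · rw [contDiff_infty_iff_deriv, hdv]
    exact ⟨fun x => (hd x).differentiableAt, hχ⟩
  · refine HasCompactSupport.of_support_subset_isCompact (isCompact_Icc (a := -R) (b := R)) ?_
    intro x hx
    by_contra hxR
    apply hx
    rw [mem_Icc, not_and_or, not_le, not_le] at hxR
    rcases hxR with h | h
    · refine setIntegral_eq_zero_of_forall_eq_zero fun t ht => hz t ?_
      rw [mem_Iic] at ht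
      rw [lt_abs]
      right
      linarith
    · change ∫ t in Iic x, χ t = 0
      rw [← h0, setIntegral_eq_integral_of_forall_compl_eq_zero]
      intro t ht
      rw [mem_Iic, not_le] at ht
      apply hz
      rw [lt_abs]
      left
      linarith

/-- Subtracting from a test function `ψ` its integral times a fixed normalized bump `θ` leaves the
derivative of a test function, so `∫ f ψ = (∫ f θ)(∫ ψ)`. The constant is `∫ f θ`. -/
lemma IsWeakDeriv.ae_eq_const {f : ℝ → ℂ} (hf : LocallyIntegrable f volume)
    (h : IsWeakDeriv f 0) : ∃ c : ℂ, f =ᵐ[volume] fun _ => c := by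
  let b : ContDiffBump (0 : ℝ) := default
  have hθs : HasCompactSupport (fun x => ((b.normed volume x : ℝ) : ℂ)) :=
    b.hasCompactSupport_normed.comp_left (g := fun y : ℝ => (y : ℂ)) Complex.ofReal_zero
  have hθ : ContDiff ℝ (⊤ : ℕ∞) (fun x => ((b.normed volume x : ℝ) : ℂ)) :=
    Complex.ofRealCLM.contDiff.comp b.contDiff_normed
  set θ : ℝ → ℂ := fun x => ((b.normed volume x : ℝ) : ℂ) with hθdef
  have hθ1 : ∫ x, θ x = 1 := by
    rw [hθdef, integral_complex_ofReal, b.integral_normed, Complex.ofReal_one]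
  have hθi : Integrable θ := hθ.continuous.integrable_of_hasCompactSupport hθs
  refine ⟨∫ x, f x * θ x, ?_⟩
  refine ae_eq_of_integral_contDiff_smul_eq hf (locallyIntegrable_const _) fun ψ hψ hψs => ?_
  have hψ' : ContDiff ℝ (⊤ : ℕ∞) (fun x => (ψ x : ℂ)) := Complex.ofRealCLM.contDiff.comp hψ
  have hψs' : HasCompactSupport (fun x => (ψ x : ℂ)) :=
    hψs.comp_left (g := fun y : ℝ => (y : ℂ)) Complex.ofReal_zero
  have hψi : Integrable (fun x => (ψ x : ℂ)) :=
    hψ'.continuous.integrable_of_hasCompactSupport hψs'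
  obtain ⟨φ, hφ, hφs, hφd⟩ := exists_primitive_of_integral_eq_zero
    (χ := fun x => (ψ x : ℂ) - (∫ y, (ψ y : ℂ)) * θ x) (hψ'.sub (contDiff_const.mul hθ))
    (hψs'.sub hθs.mul_left) (by
      rw [integral_sub hψi (hθi.const_mul _), integral_const_mul, hθ1]
      ring)
  have := h φ hφ hφs
  rw [hφd] at this
  simp only [Pi.zero_apply, zero_mul, integral_zero, neg_zero, mul_sub] at this
  rw [integral_sub (integrable_mul_of_compactSupport hf hψ'.continuous hψs')] at this
  · simp only [Complex.real_smul]
    rw [integral_mul_const]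
    have e : ∀ x, f x * ((∫ y, (ψ y : ℂ)) * θ x) = (∫ y, (ψ y : ℂ)) * (f x * θ x) :=
      fun x => by ring
    simp only [e, integral_const_mul] at this
    rw [← sub_eq_zero, ← this]
    simp only [mul_comm]
  · exact integrable_mul_of_compactSupport hf (continuous_const.mul hθ.continuous) hθs.mul_left

/-- A function with a locally integrable weak derivative is a primitive of it, up to a null set. -/
lemma IsWeakDeriv.exists_isPrimitive {f g : ℝ → ℂ} (hf : LocallyIntegrable f volume)
    (hg : LocallyIntegrable g volume) (h : IsWeakDeriv f g) :
    ∃ G, IsPrimitive G g ∧ f =ᵐ[volume] G := by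
  have hP : ∀ c : ℂ, IsPrimitive (fun x => c + ∫ t in (0 : ℝ)..x, g t) g := fun c =>
    ⟨hg, fun a b => by
      rw [add_sub_add_left_eq_sub, intervalIntegral.integral_interval_sub_left
        (hg.intervalIntegrable_real _ _) (hg.intervalIntegrable_real _ _)]⟩
  have h0 := hP 0
  have hc := h0.continuous.locallyIntegrable (μ := volume)
  obtain ⟨c, hfc⟩ := IsWeakDeriv.ae_eq_const (hf.sub hc) (fun φ hφ hs => by
    have hd := contDiff_deriv hφ
    simp only [Pi.sub_apply, sub_mul]
    rw [integral_sub (integrable_mul_of_compactSupport hf hd.continuous hs.deriv)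
      (integrable_mul_of_compactSupport hc hd.continuous hs.deriv), h φ hφ hs,
      h0.isWeakDeriv φ hφ hs]
    simp)
  refine ⟨_, hP c, hfc.mono fun x hx => ?_⟩
  simp only [Pi.sub_apply] at hx
  rw [← hx]
  ring

/-- The product rule for a weakly differentiable and a smooth function. -/
lemma IsWeakDeriv.smooth_mul {f g e : ℝ → ℂ} (hf : LocallyIntegrable f volume)
    (hg : LocallyIntegrable g volume) (h : IsWeakDeriv f g) (he : ContDiff ℝ (⊤ : ℕ∞) e) :
    IsWeakDeriv (fun x => e x * f x) (fun x => deriv e x * f x + e x * g x) := by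
  intro φ hφ hs
  have hd := contDiff_deriv hφ
  have hed := contDiff_deriv he
  have h1 := h (fun x => e x * φ x) (he.mul hφ) hs.mul_left
  have e1 : deriv (fun x => e x * φ x) = fun x => deriv e x * φ x + e x * deriv φ x :=
    funext fun x => ((hasDerivAt_of_contDiff he x).mul (hasDerivAt_of_contDiff hφ x)).deriv
  have i1 := integrable_mul_of_compactSupport hf (hed.mul hφ).continuous hs.mul_left
  have i2 := integrable_mul_of_compactSupport hf (he.mul hd).continuous hs.deriv.mul_left
  have i3 := integrable_mul_of_compactSupport hg (he.mul hφ).continuous hs.mul_left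
  rw [e1] at h1
  simp only [mul_add] at h1
  rw [integral_add i1 i2] at h1
  have e2 : ∀ x, (deriv e x * f x + e x * g x) * φ x =
      f x * (deriv e x * φ x) + g x * (e x * φ x) := fun x => by ring
  have e3 : ∀ x, e x * f x * deriv φ x = f x * (e x * deriv φ x) := fun x => by ring
  simp only [e2, e3]
  rw [integral_add i1 i3]
  linear_combination h1

/-! ### The Fourier transform on `L¹ ∩ L²` -/

lemma integral_fourier_mul_eq {f g : ℝ → ℂ} (hf : Integrable f) (hg : Integrable g) :
    ∫ ξ, 𝓕 f ξ * g ξ = ∫ x, f x * 𝓕 g x := by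
  have := VectorFourier.integral_fourierIntegral_smul_eq_flip (L := innerₗ ℝ)
    Real.continuous_fourierChar continuous_inner hf hg
  simpa only [flip_innerₗ, smul_eq_mul] using! this

lemma norm_fourier_le {f : ℝ → ℂ} (ξ : ℝ) : ‖𝓕 f ξ‖ ≤ ∫ x, ‖f x‖ :=
  VectorFourier.norm_fourierIntegral_le_integral_norm _ _ _ _ _

lemma norm_fourierInv_le {f : ℝ → ℂ} (x : ℝ) : ‖𝓕⁻ f x‖ ≤ ∫ ξ, ‖f ξ‖ := by
  rw [Real.fourierInv_eq_fourier_neg]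
  exact norm_fourier_le _

lemma continuous_fourier {f : ℝ → ℂ} (hf : Integrable f) : Continuous (𝓕 f) :=
  VectorFourier.fourierIntegral_continuous Real.continuous_fourierChar continuous_inner hf

lemma continuous_fourierInv {f : ℝ → ℂ} (hf : Integrable f) : Continuous (𝓕⁻ f) := by
  have : 𝓕⁻ f = fun x => 𝓕 f (-x) := funext fun x => Real.fourierInv_eq_fourier_neg _ _
  rw [this]
  exact (continuous_fourier hf).comp continuous_neg

/-- The `L²` Fourier transform of a function of `L¹ ∩ L²` is given by the Fourier integral. -/
lemma lpFourier_toLp_ae_eq {f : ℝ → ℂ} (hf1 : Integrable f) (hf : MemLp f 2 volume) :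
    (𝓕 (hf.toLp f : Lp ℂ 2 (volume : Measure ℝ)) : Lp ℂ 2 volume) =ᵐ[volume] 𝓕 f := by
  refine ae_eq_of_integral_contDiff_smul_eq ((Lp.memLp _).locallyIntegrable one_le_two)
    (continuous_fourier hf1).locallyIntegrable fun ψ hψ hψs => ?_
  have hψ' : ContDiff ℝ (⊤ : ℕ∞) (fun x => (ψ x : ℂ)) := Complex.ofRealCLM.contDiff.comp hψ
  have hψs' : HasCompactSupport (fun x => (ψ x : ℂ)) :=
    hψs.comp_left (g := fun y : ℝ => (y : ℂ)) Complex.ofReal_zero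
  have h1 := congrArg (fun T : 𝓢'(ℝ, ℂ) => T (hψs'.toSchwartzMap hψ'))
    (Lp.fourier_toTemperedDistribution_eq (hf.toLp f : Lp ℂ 2 (volume : Measure ℝ)))
  simp only [TemperedDistribution.fourier_apply, Lp.toTemperedDistribution_apply,
    SchwartzMap.fourier_coe, smul_eq_mul, HasCompactSupport.toSchwartzMap_toFun] at h1
  simp only [Complex.real_smul]
  refine h1.symm.trans ?_
  have h2 := integral_fourier_mul_eq hf1
    (hψ'.continuous.integrable_of_hasCompactSupport hψs' (μ := volume))
  rw [integral_congr_ae (hf.coeFn_toLp.mono fun x hx => by rw [hx])]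
  simp only [mul_comm (𝓕 f _), mul_comm (f _)] at h2
  exact h2.symm

lemma memLp_fourier {f : ℝ → ℂ} (hf1 : Integrable f) (hf : MemLp f 2 volume) :
    MemLp (𝓕 f) 2 volume :=
  (memLp_congr_ae (lpFourier_toLp_ae_eq hf1 hf)).1 (Lp.memLp _)

/-- The inverse `L²` Fourier transform of a function of `L¹ ∩ L²` is given by the Fourier
integral. -/
lemma lpFourierInv_toLp_ae_eq {f : ℝ → ℂ} (hf1 : Integrable f) (hf : MemLp f 2 volume) :
    (𝓕⁻ (hf.toLp f : Lp ℂ 2 (volume : Measure ℝ)) : Lp ℂ 2 volume) =ᵐ[volume] 𝓕⁻ f := by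
  refine ae_eq_of_integral_contDiff_smul_eq ((Lp.memLp _).locallyIntegrable one_le_two)
    (continuous_fourierInv hf1).locallyIntegrable fun ψ hψ hψs => ?_
  have hψ' : ContDiff ℝ (⊤ : ℕ∞) (fun x => (ψ x : ℂ)) := Complex.ofRealCLM.contDiff.comp hψ
  have hψs' : HasCompactSupport (fun x => (ψ x : ℂ)) :=
    hψs.comp_left (g := fun y : ℝ => (y : ℂ)) Complex.ofReal_zero
  have h1 := congrArg (fun T : 𝓢'(ℝ, ℂ) => T (hψs'.toSchwartzMap hψ'))
    (Lp.fourierInv_toTemperedDistribution_eq (hf.toLp f : Lp ℂ 2 (volume : Measure ℝ)))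
  simp only [TemperedDistribution.fourierInv_apply, Lp.toTemperedDistribution_apply,
    SchwartzMap.fourierInv_coe, smul_eq_mul, HasCompactSupport.toSchwartzMap_toFun] at h1
  simp only [Complex.real_smul]
  refine h1.symm.trans ?_
  have hψi : Integrable (fun x => (ψ x : ℂ)) :=
    hψ'.continuous.integrable_of_hasCompactSupport hψs'
  have h2 := integral_fourier_mul_eq hf1 hψi.comp_neg
  rw [integral_congr_ae (hf.coeFn_toLp.mono fun x hx => by rw [hx]),
    Real.fourierInv_eq_fourier_comp_neg]
  simp only [HasCompactSupport.toSchwartzMap_toFun]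
  rw [← integral_neg_eq_self] at h2
  simp only [neg_neg, ← Real.fourierInv_eq_fourier_neg, mul_comm (𝓕⁻ f _), mul_comm (f _)] at h2
  exact h2.symm

lemma memLp_fourierInv {f : ℝ → ℂ} (hf1 : Integrable f) (hf : MemLp f 2 volume) :
    MemLp (𝓕⁻ f) 2 volume :=
  (memLp_congr_ae (lpFourierInv_toLp_ae_eq hf1 hf)).1 (Lp.memLp _)

lemma integrable_fourier_of_fourierInv {f : ℝ → ℂ} (hf : Integrable (𝓕⁻ f)) :
    Integrable (𝓕 f) := by
  have : 𝓕 f = fun x => 𝓕⁻ f (-x) :=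
    funext fun x => by rw [Real.fourierInv_eq_fourier_neg, neg_neg]
  rw [this]
  exact hf.comp_neg

lemma fourier_fourierInv_eq_self {f : ℝ → ℂ} (hc : Continuous f) (hf : Integrable f)
    (hf' : Integrable (𝓕⁻ f)) : 𝓕 (𝓕⁻ f) = f :=
  hc.fourier_fourierInv_eq hf (integrable_fourier_of_fourierInv hf')

/-- The Fourier transform of a derivative. -/
lemma IsPrimitive.fourier_eq {G g : ℝ → ℂ} (h : IsPrimitive G g) (hG : Integrable G)
    (hg : Integrable g) (ξ : ℝ) : 𝓕 g ξ = 2 * Real.pi * Complex.I * ξ * 𝓕 G ξ := by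
  set c : ℂ := -(2 * Real.pi * Complex.I * ξ) with hc
  have hd : ∀ x : ℝ, HasDerivAt (fun x : ℝ => Complex.exp (c * x)) (c * Complex.exp (c * x)) x := by
    intro x
    have := ((hasDerivAt_id (x : ℂ)).const_mul c).cexp.comp_ofReal
    simpa [mul_comm] using this
  have hcont : Continuous fun x : ℝ => Complex.exp (c * x) := by fun_prop
  have hnorm : ∀ x : ℝ, ‖Complex.exp (c * x)‖ ≤ 1 := by
    intro x
    rw [Complex.norm_exp]
    simp [hc]
  have e1 : ∀ f : ℝ → ℂ, 𝓕 f ξ = ∫ x : ℝ, Complex.exp (c * x) * f x := by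
    intro f
    rw [Real.fourier_real_eq_integral_exp_smul]
    congr 1
    ext x
    rw [smul_eq_mul]
    congr 2
    rw [hc]
    push_cast
    ring
  have hi : ∀ {f : ℝ → ℂ}, Integrable f → Integrable (fun x : ℝ => Complex.exp (c * x) * f x) :=
    fun hf => hf.bdd_mul hcont.aestronglyMeasurable (ae_of_all _ hnorm)
  have hP := (IsPrimitive.of_hasDerivAt hd (continuous_const.mul hcont)).mul h
  have i1 : Integrable fun x : ℝ => c * Complex.exp (c * x) * G x := by
    simpa only [mul_assoc] using (hi hG).const_mul c
  have := hP.integral_eq_zero (hi hG) (i1.add (hi hg))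
  rw [integral_add i1 (hi hg)] at this
  simp only [mul_assoc, integral_const_mul] at this
  rw [e1, e1]
  simp only [hc] at this ⊢
  linear_combination this

/-! ### Sobolev functions -/

lemma MemH1.memLp {f : ℝ → ℂ} (hf : MemH1 f) : MemLp f 2 volume := hf.choose

lemma MemH1.exists_isWeakDeriv {f : ℝ → ℂ} (hf : MemH1 f) :
    ∃ g : ℝ → ℂ, MemLp g 2 volume ∧ IsWeakDeriv f g := by
  obtain ⟨hf2, hS⟩ := hf
  have h1 := hS.lineDerivOp (m := (1 : ℝ))
  rw [sub_self, TemperedDistribution.memSobolev_zero_iff] at h1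
  obtain ⟨g, hg⟩ := h1
  refine ⟨g, Lp.memLp g, fun φ hφ hs => ?_⟩
  have h2 := congrArg (fun T : 𝓢'(ℝ, ℂ) => T (hs.toSchwartzMap hφ)) hg
  simp only [TemperedDistribution.lineDerivOp_apply_apply, map_neg,
    Lp.toTemperedDistribution_apply, SchwartzMap.lineDerivOp_apply_eq_fderiv,
    HasCompactSupport.toSchwartzMap_toFun, smul_eq_mul, fderiv_apply_one_eq_deriv] at h2
  simp only [mul_comm _ (φ _)]
  rw [← h2, neg_neg]
  refine integral_congr_ae (hf2.coeFn_toLp.mono fun x hx => ?_)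
  simp only
  rw [hx, mul_comm, ← fderiv_apply_one_eq_deriv]
  rfl

/-! ### Convolutions of functions supported on a half-line -/

/-- The symbol of `2 Π₊ ρ` may jump at the origin, so one discontinuity of `b` is allowed: it is met
only at `t = ξ`, a null set, and dominated convergence applies. Continuity is needed because Fourier
inversion is later evaluated at single frequencies. -/
lemma continuous_convolution_of_bounded {a b : ℝ → ℂ} (ha : Integrable a)
    (hb : AEStronglyMeasurable b volume) {C : ℝ} (hC : ∀ x, ‖b x‖ ≤ C)
    (hbc : ∀ x, x ≠ 0 → ContinuousAt b x) :
    Continuous (a ⋆[ContinuousLinearMap.mul ℂ ℂ] b) := by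
  rw [continuous_iff_continuousAt]
  intro ξ
  have e : (a ⋆[ContinuousLinearMap.mul ℂ ℂ] b) = fun ξ => ∫ t, a t * b (ξ - t) := rfl
  rw [e]
  refine continuousAt_of_dominated (bound := fun t => ‖a t‖ * C) ?_ ?_ (ha.norm.mul_const C) ?_
  · refine Eventually.of_forall fun x => ha.aestronglyMeasurable.mul ?_
    exact hb.comp_quasiMeasurePreserving (quasiMeasurePreserving_sub_left volume x)
  · refine Eventually.of_forall fun x => ae_of_all _ fun t => ?_
    rw [norm_mul]
    exact mul_le_mul_of_nonneg_left (hC _) (norm_nonneg _)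
  · have : ∀ᵐ t : ℝ, t ≠ ξ := by
      rw [ae_iff]
      simp
    filter_upwards [this] with t ht
    refine continuousAt_const.mul ?_
    exact ContinuousAt.comp (f := fun x => x - t) (hbc _ (sub_ne_zero.2 (Ne.symm ht)))
      (by fun_prop)

lemma convolution_eq_zero_of_nonpos {a b : ℝ → ℂ} (ha : ∀ x ≤ 0, a x = 0)
    (hb : ∀ x ≤ 0, b x = 0) {ξ : ℝ} (hξ : ξ ≤ 0) :
    (a ⋆[ContinuousLinearMap.mul ℂ ℂ] b) ξ = 0 := by
  rw [convolution_def]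
  refine integral_eq_zero_of_ae (ae_of_all _ fun t => ?_)
  simp only [ContinuousLinearMap.mul_apply', Pi.zero_apply]
  rcases le_or_gt t 0 with h | h
  · rw [ha t h, zero_mul]
  · rw [hb _ (by linarith), mul_zero]

lemma fourierInv_convolution {a b : ℝ → ℂ} (ha : Integrable a) (hb : Integrable b) (x : ℝ) :
    𝓕⁻ (a ⋆[ContinuousLinearMap.mul ℂ ℂ] b) x = 𝓕⁻ a x * 𝓕⁻ b x := by
  simp only [Real.fourierInv_eq_fourier_neg]
  exact Real.fourier_mul_convolution_eq ha hb _

lemma norm_convolution_le {a b : ℝ → ℂ} (ha : Integrable a) {C : ℝ} (hC : ∀ x, ‖b x‖ ≤ C)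
    (ξ : ℝ) : ‖(a ⋆[ContinuousLinearMap.mul ℂ ℂ] b) ξ‖ ≤ (∫ t, ‖a t‖) * C := by
  rw [convolution_def, ← integral_mul_const]
  refine norm_integral_le_of_norm_le (ha.norm.mul_const C) (ae_of_all _ fun t => ?_)
  simp only [ContinuousLinearMap.mul_apply', norm_mul]
  exact mul_le_mul_of_nonneg_left (hC _) (norm_nonneg _)

/-- If `a` vanishes on `(-∞, 0]` and is at most of linear growth, then `a ⋆ a` is at most of cubic
growth. -/
lemma norm_convolution_le_cube {a : ℝ → ℂ} (ha0 : ∀ x ≤ 0, a x = 0) {C : ℝ}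
    (hC : ∀ x, ‖a x‖ ≤ C * |x|) (hC0 : 0 ≤ C) {ξ : ℝ} (hξ : 0 ≤ ξ) :
    ‖(a ⋆[ContinuousLinearMap.mul ℂ ℂ] a) ξ‖ ≤ C ^ 2 * ξ ^ 3 := by
  have e : (a ⋆[ContinuousLinearMap.mul ℂ ℂ] a) ξ = ∫ t in Ioc 0 ξ, a t * a (ξ - t) := by
    rw [convolution_def, ← setIntegral_eq_integral_of_forall_compl_eq_zero (s := Ioc 0 ξ)]
    · rfl
    · intro t ht
      simp only [ContinuousLinearMap.mul_apply']
      rw [mem_Ioc, not_and_or, not_lt, not_le] at ht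
      rcases ht with h | h
      · rw [ha0 t h, zero_mul]
      · rw [ha0 (ξ - t) (by linarith), mul_zero]
  rw [e]
  have hb : ∀ t ∈ Ioc 0 ξ, ‖a t * a (ξ - t)‖ ≤ C ^ 2 * ξ ^ 2 := by
    intro t ht
    rw [norm_mul]
    have h1 : ‖a t‖ ≤ C * ξ := (hC t).trans
      (mul_le_mul_of_nonneg_left (by rw [abs_of_pos ht.1]; exact ht.2) hC0)
    have h2 : ‖a (ξ - t)‖ ≤ C * ξ := (hC _).trans
      (mul_le_mul_of_nonneg_left
        (by rw [abs_of_nonneg (by linarith [ht.2])]; linarith [ht.1]) hC0)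
    calc ‖a t‖ * ‖a (ξ - t)‖ ≤ (C * ξ) * (C * ξ) :=
          mul_le_mul h1 h2 (norm_nonneg _) (by positivity)
      _ = C ^ 2 * ξ ^ 2 := by ring
  have := norm_setIntegral_le_of_norm_le_const (μ := volume) (by simp) hb
  refine this.trans (le_of_eq ?_)
  rw [Real.volume_real_Ioc_of_le hξ]
  ring

/-! ### The Hardy projection of a regular real density -/

lemma fourier_conj (f : ℝ → ℂ) (ξ : ℝ) :
    𝓕 (fun x => starRingEnd ℂ (f x)) ξ = starRingEnd ℂ (𝓕 f (-ξ)) := by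
  rw [Real.fourier_real_eq_integral_exp_smul, Real.fourier_real_eq_integral_exp_smul,
    ← integral_conj]
  congr 1
  ext x
  simp only [smul_eq_mul, map_mul, ← Complex.exp_conj, Complex.conj_I, Complex.conj_ofReal]
  congr 2
  push_cast
  ring

lemma conj_fourierInv (f : ℝ → ℂ) (x : ℝ) :
    starRingEnd ℂ (𝓕⁻ f x) = 𝓕⁻ (fun ξ => starRingEnd ℂ (f (-ξ))) x := by
  rw [Real.fourierInv_eq_fourier_neg, Real.fourierInv_eq_fourier_comp_neg]
  simp only [neg_neg]
  exact (fourier_conj f x).symm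

/-- A real density `ρ` with integrable first and second derivatives `ρ₁`, `ρ₂`, where `ρ` and `ρ₂`
are also square integrable. -/
structure IsRegularDensity (ρ ρ₁ ρ₂ : ℝ → ℂ) : Prop where
  isPrimitive : IsPrimitive ρ ρ₁
  isPrimitive' : IsPrimitive ρ₁ ρ₂
  conj_eq : ∀ x, starRingEnd ℂ (ρ x) = ρ x
  integrable : Integrable ρ
  integrable₁ : Integrable ρ₁
  integrable₂ : Integrable ρ₂
  memLp : MemLp ρ 2 volume
  memLp₂ : MemLp ρ₂ 2 volume

/-- The symbol of `2 Π₊ ρ`, where `Π₊` is the projection to the positive frequencies. -/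
noncomputable def posFreq (ρ : ℝ → ℂ) (ξ : ℝ) : ℂ := if 0 < ξ then 2 * 𝓕 ρ ξ else 0

/-- The symbol of the derivative of `2 Π₊ ρ`. -/
noncomputable def posFreqDeriv (ρ : ℝ → ℂ) (ξ : ℝ) : ℂ :=
  2 * Real.pi * Complex.I * ξ * posFreq ρ ξ

/-- The function `2 Π₊ ρ`. -/
noncomputable def hardyPart (ρ : ℝ → ℂ) : ℝ → ℂ := 𝓕⁻ (posFreq ρ)

/-- The derivative of the function `2 Π₊ ρ`. -/
noncomputable def hardyDeriv (ρ : ℝ → ℂ) : ℝ → ℂ := 𝓕⁻ (posFreqDeriv ρ)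

lemma posFreq_of_nonpos (ρ : ℝ → ℂ) {ξ : ℝ} (h : ξ ≤ 0) : posFreq ρ ξ = 0 :=
  if_neg (not_lt.2 h)

lemma posFreqDeriv_of_nonpos (ρ : ℝ → ℂ) {ξ : ℝ} (h : ξ ≤ 0) : posFreqDeriv ρ ξ = 0 := by
  rw [posFreqDeriv, posFreq_of_nonpos ρ h, mul_zero]

lemma norm_posFreq_le (ρ : ℝ → ℂ) (ξ : ℝ) : ‖posFreq ρ ξ‖ ≤ 2 * ‖𝓕 ρ ξ‖ := by
  rw [posFreq]
  split_ifs
  · simp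
  · simp

lemma norm_posFreqDeriv_eq (ρ : ℝ → ℂ) (ξ : ℝ) :
    ‖posFreqDeriv ρ ξ‖ = 2 * Real.pi * |ξ| * ‖posFreq ρ ξ‖ := by
  rw [posFreqDeriv]
  simp [abs_of_pos Real.pi_pos]

/-! ### Integrability and regularity of the Hardy part, and products of Hardy functions. -/

namespace IsRegularDensity

variable {ρ ρ₁ ρ₂ : ℝ → ℂ}

lemma fourier_neg (h : IsRegularDensity ρ ρ₁ ρ₂) (ξ : ℝ) :
    𝓕 ρ (-ξ) = starRingEnd ℂ (𝓕 ρ ξ) := by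
  have := fourier_conj ρ (-ξ)
  simp only [h.conj_eq, neg_neg] at this
  exact this

/-- Two derivatives in `L²` put `ξ² 𝓕 ρ` in `L²`; all the decay of the symbols below comes from
this. -/
lemma memLp_weight (h : IsRegularDensity ρ ρ₁ ρ₂) :
    MemLp (fun ξ : ℝ => (1 + (ξ : ℂ) ^ 2) * 𝓕 ρ ξ) 2 volume := by
  have h1 := memLp_fourier h.integrable h.memLp
  have h2 := (memLp_fourier h.integrable₂ h.memLp₂).const_mul (-(1 / (4 * Real.pi ^ 2) : ℂ))
  refine (memLp_congr_ae (ae_of_all _ fun ξ => ?_)).1 (h1.add h2)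
  simp only [Pi.add_apply]
  rw [h.isPrimitive'.fourier_eq h.integrable₁ h.integrable₂,
    h.isPrimitive.fourier_eq h.integrable h.integrable₁]
  have hpi : (Real.pi : ℂ) ≠ 0 := Complex.ofReal_ne_zero.2 Real.pi_ne_zero
  field_simp
  linear_combination (-(ξ : ℂ) ^ 2 * 𝓕 ρ ξ * 4) * Complex.I_sq

lemma norm_weight (ρ : ℝ → ℂ) (ξ : ℝ) :
    ‖(1 + (ξ : ℂ) ^ 2) * 𝓕 ρ ξ‖ = (1 + ξ ^ 2) * ‖𝓕 ρ ξ‖ := by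
  rw [norm_mul]
  congr 1
  have : (1 + (ξ : ℂ) ^ 2) = ((1 + ξ ^ 2 : ℝ) : ℂ) := by push_cast; ring
  rw [this, Complex.norm_real, Real.norm_of_nonneg (by positivity)]

lemma integrable_majorant (h : IsRegularDensity ρ ρ₁ ρ₂) :
    Integrable fun ξ : ℝ => ((1 + ξ ^ 2) * ‖𝓕 ρ ξ‖) ^ 2 + (1 + ξ ^ 2)⁻¹ := by
  refine Integrable.add ?_ integrable_inv_one_add_sq
  have := h.memLp_weight.integrable_norm_pow two_ne_zero
  simpa only [norm_weight] using this

/-- The arithmetic-geometric inequality for `s n` and `(1 + |ξ|) / (2 s)`, with `s = 1 + ξ²`, trades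
the weighted `L²` bound for integrability of `(1 + |ξ|) 𝓕 ρ`. -/
lemma majorant (ρ : ℝ → ℂ) (ξ : ℝ) :
    (1 + |ξ|) * ‖𝓕 ρ ξ‖ ≤ ((1 + ξ ^ 2) * ‖𝓕 ρ ξ‖) ^ 2 + (1 + ξ ^ 2)⁻¹ := by
  set n := ‖𝓕 ρ ξ‖
  set s := 1 + ξ ^ 2 with hs
  have hs0 : 0 < s := by positivity
  have h1 : (1 + |ξ|) ^ 2 ≤ 4 * s := by
    rw [hs, ← sq_abs ξ]
    nlinarith [sq_nonneg (1 - |ξ|)]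
  have h2 : s * s⁻¹ = 1 := mul_inv_cancel₀ hs0.ne'
  have hi : 0 < s⁻¹ := inv_pos.2 hs0
  have h3 : ((1 + |ξ|) * s⁻¹) ^ 2 ≤ 4 * s⁻¹ := by
    calc ((1 + |ξ|) * s⁻¹) ^ 2 = (1 + |ξ|) ^ 2 * (s⁻¹ ^ 2) := by ring
      _ ≤ 4 * s * s⁻¹ ^ 2 := by gcongr
      _ = 4 * s⁻¹ * (s * s⁻¹) := by ring
      _ = 4 * s⁻¹ := by rw [h2, mul_one]
  have h4 := sq_nonneg (s * n - (1 + |ξ|) * s⁻¹ / 2)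
  have h5 : s * n * ((1 + |ξ|) * s⁻¹) = (1 + |ξ|) * n := by
    calc s * n * ((1 + |ξ|) * s⁻¹) = (1 + |ξ|) * n * (s * s⁻¹) := by ring
      _ = _ := by rw [h2, mul_one]
  nlinarith

lemma measurable_posFreq (h : IsRegularDensity ρ ρ₁ ρ₂) : Measurable (posFreq ρ) :=
  Measurable.ite measurableSet_Ioi
    ((continuous_fourier h.integrable).measurable.const_mul 2) measurable_const

lemma aestronglyMeasurable_posFreq (h : IsRegularDensity ρ ρ₁ ρ₂) :
    AEStronglyMeasurable (posFreq ρ) volume :=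
  h.measurable_posFreq.aestronglyMeasurable

lemma aestronglyMeasurable_posFreqDeriv (h : IsRegularDensity ρ ρ₁ ρ₂) :
    AEStronglyMeasurable (posFreqDeriv ρ) volume :=
  (Measurable.mul (by fun_prop) h.measurable_posFreq).aestronglyMeasurable

lemma integrable_fourier (h : IsRegularDensity ρ ρ₁ ρ₂) : Integrable (𝓕 ρ) := by
  refine h.integrable_majorant.mono' (continuous_fourier h.integrable).aestronglyMeasurable
    (ae_of_all _ fun ξ => le_trans ?_ (majorant ρ ξ))
  exact le_mul_of_one_le_left (norm_nonneg _) (by linarith [abs_nonneg ξ])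

lemma integrable_posFreq (h : IsRegularDensity ρ ρ₁ ρ₂) : Integrable (posFreq ρ) :=
  (h.integrable_fourier.norm.const_mul 2).mono' h.aestronglyMeasurable_posFreq
    (ae_of_all _ fun ξ => norm_posFreq_le ρ ξ)

lemma integrable_posFreqDeriv (h : IsRegularDensity ρ ρ₁ ρ₂) : Integrable (posFreqDeriv ρ) := by
  refine (h.integrable_majorant.const_mul (4 * Real.pi)).mono' h.aestronglyMeasurable_posFreqDeriv
    (ae_of_all _ fun ξ => ?_)
  rw [norm_posFreqDeriv_eq]
  calc 2 * Real.pi * |ξ| * ‖posFreq ρ ξ‖ ≤ 2 * Real.pi * |ξ| * (2 * ‖𝓕 ρ ξ‖) := by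
        gcongr
        exact norm_posFreq_le ρ ξ
    _ = 4 * Real.pi * (|ξ| * ‖𝓕 ρ ξ‖) := by ring
    _ ≤ 4 * Real.pi * ((1 + |ξ|) * ‖𝓕 ρ ξ‖) := by
        gcongr
        linarith
    _ ≤ _ := by
        gcongr
        exact majorant ρ ξ

lemma memLp_posFreq (h : IsRegularDensity ρ ρ₁ ρ₂) : MemLp (posFreq ρ) 2 volume :=
  ((memLp_fourier h.integrable h.memLp).const_mul 2).mono h.aestronglyMeasurable_posFreq
    (ae_of_all _ fun ξ => by simpa using norm_posFreq_le ρ ξ)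

lemma memLp_posFreqDeriv (h : IsRegularDensity ρ ρ₁ ρ₂) : MemLp (posFreqDeriv ρ) 2 volume := by
  refine (h.memLp_weight.const_mul (4 * Real.pi : ℂ)).mono h.aestronglyMeasurable_posFreqDeriv
    (ae_of_all _ fun ξ => ?_)
  rw [norm_posFreqDeriv_eq, norm_mul, norm_weight]
  have h4 : ‖(4 * Real.pi : ℂ)‖ = 4 * Real.pi := by simp [abs_of_pos Real.pi_pos]
  rw [h4]
  have hx : |ξ| ≤ 1 + ξ ^ 2 := by
    rw [← sq_abs ξ]
    nlinarith [sq_nonneg (|ξ| - 1), abs_nonneg ξ]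
  calc 2 * Real.pi * |ξ| * ‖posFreq ρ ξ‖ ≤ 2 * Real.pi * (1 + ξ ^ 2) * (2 * ‖𝓕 ρ ξ‖) := by
        gcongr
        exact norm_posFreq_le ρ ξ
    _ = _ := by ring

lemma continuousAt_posFreq (h : IsRegularDensity ρ ρ₁ ρ₂) {ξ : ℝ} (hξ : ξ ≠ 0) :
    ContinuousAt (posFreq ρ) ξ := by
  rcases lt_or_gt_of_ne hξ with hlt | hgt
  · refine (continuousAt_const (y := (0 : ℂ))).congr ?_
    filter_upwards [Iio_mem_nhds hlt] with x hx
    exact (posFreq_of_nonpos ρ (le_of_lt hx)).symm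
  · refine ((continuous_fourier h.integrable).continuousAt.const_mul 2).congr ?_
    filter_upwards [Ioi_mem_nhds hgt] with x hx
    exact (if_pos hx).symm

lemma norm_posFreq_le_integral (_h : IsRegularDensity ρ ρ₁ ρ₂) (ξ : ℝ) :
    ‖posFreq ρ ξ‖ ≤ 2 * ∫ x, ‖ρ x‖ :=
  (norm_posFreq_le ρ ξ).trans (mul_le_mul_of_nonneg_left (norm_fourier_le ξ) zero_le_two)

/-- The factor `ξ` removes the jump of `posFreq ρ` at the origin. -/
lemma continuous_posFreqDeriv (h : IsRegularDensity ρ ρ₁ ρ₂) : Continuous (posFreqDeriv ρ) := by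
  rw [continuous_iff_continuousAt]
  intro ξ
  rcases eq_or_ne ξ 0 with rfl | hξ
  · have h0 : posFreqDeriv ρ 0 = 0 := posFreqDeriv_of_nonpos ρ le_rfl
    rw [ContinuousAt, h0]
    refine squeeze_zero_norm (a := fun x : ℝ => 2 * Real.pi * |x| * (2 * ∫ x, ‖ρ x‖))
      (fun x => ?_) ?_
    · rw [norm_posFreqDeriv_eq]
      gcongr
      exact h.norm_posFreq_le_integral x
    · have : Continuous fun x : ℝ => 2 * Real.pi * |x| * (2 * ∫ x, ‖ρ x‖) := by fun_prop
      simpa using this.tendsto 0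
  · exact ContinuousAt.mul (by fun_prop) (h.continuousAt_posFreq hξ)

lemma fourierInv_fourier (h : IsRegularDensity ρ ρ₁ ρ₂) : 𝓕⁻ (𝓕 ρ) = ρ :=
  h.isPrimitive.continuous.fourierInv_fourier_eq h.integrable h.integrable_fourier

lemma fourierInv_add {f g : ℝ → ℂ} (hf : Integrable f) (hg : Integrable g) (x : ℝ) :
    𝓕⁻ (fun ξ => f ξ + g ξ) x = 𝓕⁻ f x + 𝓕⁻ g x := by
  simp only [Real.fourierInv_eq_fourier_neg]
  have := VectorFourier.fourierIntegral_add (L := innerₗ ℝ)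
    Real.continuous_fourierChar continuous_inner hf hg
  exact congrFun this (-x)

lemma fourierInv_const_mul (c : ℂ) (f : ℝ → ℂ) (x : ℝ) :
    𝓕⁻ (fun ξ => c * f ξ) x = c * 𝓕⁻ f x := by
  simp only [Real.fourierInv_eq_fourier_neg, Real.fourier_real_eq_integral_exp_smul, smul_eq_mul]
  rw [← integral_const_mul]
  congr 1
  ext
  ring

/-- For real `ρ` the transform is Hermitian, so conjugating the positive-frequency part produces
exactly the negative-frequency part; the factor in `posFreq` doubles both. -/
lemma hardyPart_add_conj (h : IsRegularDensity ρ ρ₁ ρ₂) (x : ℝ) :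
    hardyPart ρ x + starRingEnd ℂ (hardyPart ρ x) = 2 * ρ x := by
  have hi : Integrable fun ξ => starRingEnd ℂ (posFreq ρ (-ξ)) :=
    Complex.conjCLE.toContinuousLinearMap.integrable_comp h.integrable_posFreq.comp_neg
  rw [hardyPart, conj_fourierInv, ← fourierInv_add h.integrable_posFreq hi]
  have e : (fun ξ => posFreq ρ ξ + starRingEnd ℂ (posFreq ρ (-ξ))) =ᵐ[volume]
      fun ξ => 2 * 𝓕 ρ ξ := by
    have : ∀ᵐ t : ℝ, t ≠ 0 := by
      rw [ae_iff]
      simp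
    filter_upwards [this] with ξ hξ
    rcases lt_or_gt_of_ne hξ with hlt | hgt
    · rw [posFreq_of_nonpos ρ hlt.le, posFreq, if_pos (by linarith), h.fourier_neg, map_mul,
        Complex.conj_conj, zero_add, Complex.conj_ofNat]
    · rw [posFreq_of_nonpos ρ (ξ := -ξ) (by linarith), posFreq, if_pos hgt, map_zero, add_zero]
  rw [Real.fourierInv_congr_ae e, fourierInv_const_mul, h.fourierInv_fourier]

lemma hardyPart_re (h : IsRegularDensity ρ ρ₁ ρ₂) (x : ℝ) : (hardyPart ρ x).re = (ρ x).re := by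
  have := congrArg Complex.re (h.hardyPart_add_conj x)
  simp at this
  linarith

lemma hasDerivAt_hardyPart (h : IsRegularDensity ρ ρ₁ ρ₂) (x : ℝ) :
    HasDerivAt (hardyPart ρ) (hardyDeriv ρ x) x := by
  have hi : Integrable (fun ξ : ℝ => ξ • posFreq ρ ξ) := by
    refine (h.integrable_posFreqDeriv.const_mul (2 * Real.pi * Complex.I)⁻¹).congr
      (ae_of_all _ fun ξ => ?_)
    have hpi : (2 * Real.pi * Complex.I : ℂ) ≠ 0 := by simp [Real.pi_ne_zero]
    simp only [posFreqDeriv, Complex.real_smul]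
    rw [mul_assoc _ (ξ : ℂ), inv_mul_cancel_left₀ hpi]
  have h1 := Real.hasDerivAt_fourier h.integrable_posFreq hi (-x)
  have e : hardyPart ρ = fun x => 𝓕 (posFreq ρ) (-x) :=
    funext fun x => Real.fourierInv_eq_fourier_neg _ _
  rw [e]
  have h2 := h1.scomp x (hasDerivAt_neg x)
  refine h2.congr_deriv ?_
  rw [hardyDeriv, Real.fourierInv_eq_fourier_neg, Real.fourier_real_eq_integral_exp_smul,
    Real.fourier_real_eq_integral_exp_smul, neg_smul, one_smul, ← integral_neg]
  congr 1
  ext ξ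
  simp only [posFreqDeriv, smul_eq_mul]
  ring

lemma memLp_hardyPart (h : IsRegularDensity ρ ρ₁ ρ₂) : MemLp (hardyPart ρ) 2 volume :=
  memLp_fourierInv h.integrable_posFreq h.memLp_posFreq

lemma memLp_hardyDeriv (h : IsRegularDensity ρ ρ₁ ρ₂) : MemLp (hardyDeriv ρ) 2 volume :=
  memLp_fourierInv h.integrable_posFreqDeriv h.memLp_posFreqDeriv

lemma continuous_hardyPart (h : IsRegularDensity ρ ρ₁ ρ₂) : Continuous (hardyPart ρ) :=
  continuous_fourierInv h.integrable_posFreq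

lemma continuous_hardyDeriv (h : IsRegularDensity ρ ρ₁ ρ₂) : Continuous (hardyDeriv ρ) :=
  continuous_fourierInv h.integrable_posFreqDeriv

lemma norm_hardyPart_le (ρ : ℝ → ℂ) (x : ℝ) : ‖hardyPart ρ x‖ ≤ ∫ ξ, ‖posFreq ρ ξ‖ :=
  norm_fourierInv_le x

lemma norm_hardyDeriv_le (ρ : ℝ → ℂ) (x : ℝ) : ‖hardyDeriv ρ x‖ ≤ ∫ ξ, ‖posFreqDeriv ρ ξ‖ :=
  norm_fourierInv_le x

/-- The nonlocal term of the equation is `(D + |D|) ρ = -i ∂ₓ (2 Π₊ ρ)`. -/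
lemma dAddAbsD_ae_eq (h : IsRegularDensity ρ ρ₁ ρ₂) {f : ℝ → ℂ} (hf : f =ᵐ[volume] ρ) :
    DAddAbsD f =ᵐ[volume] fun x => -Complex.I * hardyDeriv ρ x := by
  have hfL : MemLp f 2 volume := (memLp_congr_ae hf).2 h.memLp
  have h𝓕 : (𝓕 (hfL.toLp f : Lp ℂ 2 (volume : Measure ℝ)) : Lp ℂ 2 volume) =ᵐ[volume] 𝓕 ρ := by
    rw [(MemLp.toLp_eq_toLp_iff hfL h.memLp).2 hf]
    exact lpFourier_toLp_ae_eq h.integrable h.memLp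
  have hm : (fun ξ : ℝ => ((2 * Real.pi * ξ + |2 * Real.pi * ξ| : ℝ) : ℂ) *
      (𝓕 (hfL.toLp f : Lp ℂ 2 (volume : Measure ℝ)) : Lp ℂ 2 volume) ξ) =ᵐ[volume]
      fun ξ => -Complex.I * posFreqDeriv ρ ξ := by
    filter_upwards [h𝓕] with ξ hξ
    rw [hξ, posFreqDeriv, posFreq]
    have hpi := Real.pi_pos
    split_ifs with h0
    · rw [abs_of_pos (by positivity)]
      push_cast
      linear_combination (4 * Real.pi * ξ * 𝓕 ρ ξ) * Complex.I_sq
    · rw [abs_of_nonpos (mul_nonpos_of_nonneg_of_nonpos (by positivity) (not_lt.1 h0))]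
      simp
  have hL : MemLp (fun ξ => -Complex.I * posFreqDeriv ρ ξ) 2 volume :=
    h.memLp_posFreqDeriv.const_mul _
  have hmL := (memLp_congr_ae hm).2 hL
  have e : DAddAbsD f = (𝓕⁻ (hL.toLp _ : Lp ℂ 2 (volume : Measure ℝ)) : Lp ℂ 2 volume) := by
    rw [DAddAbsD, dif_pos hfL, multiplier, dif_pos hmL,
      (MemLp.toLp_eq_toLp_iff hmL hL).2 hm]
  rw [e]
  refine (lpFourierInv_toLp_ae_eq (h.integrable_posFreqDeriv.const_mul _) hL).trans
    (ae_of_all _ fun x => ?_)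
  exact fourierInv_const_mul _ _ _

lemma convolution_posFreq (h : IsRegularDensity ρ ρ₁ ρ₂) :
    Continuous (posFreq ρ ⋆[ContinuousLinearMap.mul ℂ ℂ] posFreq ρ) ∧
    Integrable (posFreq ρ ⋆[ContinuousLinearMap.mul ℂ ℂ] posFreq ρ) ∧
    (∀ x, 𝓕⁻ (posFreq ρ ⋆[ContinuousLinearMap.mul ℂ ℂ] posFreq ρ) x = hardyPart ρ x ^ 2) :=
  ⟨continuous_convolution_of_bounded h.integrable_posFreq h.aestronglyMeasurable_posFreq
      h.norm_posFreq_le_integral fun _ hx => h.continuousAt_posFreq hx,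
    h.integrable_posFreq.integrable_convolution _ h.integrable_posFreq,
    fun x => by
      rw [fourierInv_convolution h.integrable_posFreq h.integrable_posFreq, sq, hardyPart]⟩

/-- The integral of the cube of a Hardy function vanishes. -/
lemma integral_hardyPart_cube (h : IsRegularDensity ρ ρ₁ ρ₂) :
    Integrable (fun x => hardyPart ρ x ^ 3) ∧ ∫ x, hardyPart ρ x ^ 3 = 0 := by
  obtain ⟨hc, hi, he⟩ := h.convolution_posFreq
  set b := posFreq ρ ⋆[ContinuousLinearMap.mul ℂ ℂ] posFreq ρ with hb
  have hint : Integrable (fun x => hardyPart ρ x ^ 3) := by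
    have h1 : Integrable (hardyPart ρ * hardyPart ρ) :=
      h.memLp_hardyPart.integrable_mul h.memLp_hardyPart
    refine (h1.bdd_mul h.continuous_hardyPart.aestronglyMeasurable
      (ae_of_all _ (norm_hardyPart_le ρ))).congr (ae_of_all _ fun x => ?_)
    simp only [Pi.mul_apply]
    ring
  refine ⟨hint, ?_⟩
  have e : 𝓕⁻ (posFreq ρ ⋆[ContinuousLinearMap.mul ℂ ℂ] b) = fun x => hardyPart ρ x ^ 3 := by
    ext x
    rw [fourierInv_convolution h.integrable_posFreq hi, he, hardyPart]
    ring
  have hcont : Continuous (posFreq ρ ⋆[ContinuousLinearMap.mul ℂ ℂ] b) :=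
    continuous_convolution_of_bounded h.integrable_posFreq hi.aestronglyMeasurable
      (norm_convolution_le h.integrable_posFreq h.norm_posFreq_le_integral)
      fun x _ => hc.continuousAt
  -- The integral of the cube is its transform at frequency zero, where the triple convolution of
  -- symbols supported on the positive half-line vanishes.
  have h0 := congrFun (fourier_fourierInv_eq_self hcont
    (h.integrable_posFreq.integrable_convolution _ hi) (by rw [e]; exact hint)) 0
  rw [e, convolution_eq_zero_of_nonpos (fun x hx => posFreq_of_nonpos ρ hx)
    (fun x hx => convolution_eq_zero_of_nonpos (fun x hx => posFreq_of_nonpos ρ hx)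
      (fun x hx => posFreq_of_nonpos ρ hx) hx) le_rfl,
    Real.fourier_real_eq_integral_exp_smul] at h0
  simpa using h0

lemma integrable_hardyDeriv_sq (h : IsRegularDensity ρ ρ₁ ρ₂) :
    Integrable (fun x => hardyDeriv ρ x ^ 2) :=
  (h.memLp_hardyDeriv.integrable_mul h.memLp_hardyDeriv).congr
    (ae_of_all _ fun x => by simp only [Pi.mul_apply]; ring)

lemma fourier_hardyDeriv_sq (h : IsRegularDensity ρ ρ₁ ρ₂) :
    𝓕 (fun x => hardyDeriv ρ x ^ 2) =
      posFreqDeriv ρ ⋆[ContinuousLinearMap.mul ℂ ℂ] posFreqDeriv ρ := by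
  have e : 𝓕⁻ (posFreqDeriv ρ ⋆[ContinuousLinearMap.mul ℂ ℂ] posFreqDeriv ρ) =
      fun x => hardyDeriv ρ x ^ 2 := by
    ext x
    rw [fourierInv_convolution h.integrable_posFreqDeriv h.integrable_posFreqDeriv, sq, hardyDeriv]
  -- Despite the factor `ξ` the symbol is bounded: for positive `ξ` it is twice the transform of the
  -- integrable function `ρ₁`.
  obtain ⟨C, hC⟩ : ∃ C, ∀ x, ‖posFreqDeriv ρ x‖ ≤ C := by
    refine ⟨2 * ∫ x, ‖ρ₁ x‖, fun ξ => ?_⟩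
    rw [posFreqDeriv, posFreq]
    split_ifs
    · have h1 := h.isPrimitive.fourier_eq h.integrable h.integrable₁ ξ
      have : 2 * Real.pi * Complex.I * ξ * (2 * 𝓕 ρ ξ) = 2 * 𝓕 ρ₁ ξ := by
        rw [h1]
        ring
      rw [this, norm_mul, Complex.norm_ofNat]
      exact mul_le_mul_of_nonneg_left (norm_fourier_le ξ) zero_le_two
    · rw [mul_zero, norm_zero]
      have : 0 ≤ ∫ x, ‖ρ₁ x‖ := integral_nonneg fun _ => norm_nonneg _
      positivity
  have hc := continuous_convolution_of_bounded h.integrable_posFreqDeriv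
    h.aestronglyMeasurable_posFreqDeriv hC fun x _ => h.continuous_posFreqDeriv.continuousAt
  rw [← e]
  exact fourier_fourierInv_eq_self hc
    (h.integrable_posFreqDeriv.integrable_convolution _ h.integrable_posFreqDeriv)
    (by rw [e]; exact h.integrable_hardyDeriv_sq)

lemma fourier_hardyDeriv_sq_of_nonpos (h : IsRegularDensity ρ ρ₁ ρ₂) {ξ : ℝ} (hξ : ξ ≤ 0) :
    𝓕 (fun x => hardyDeriv ρ x ^ 2) ξ = 0 := by
  rw [h.fourier_hardyDeriv_sq]
  exact convolution_eq_zero_of_nonpos (fun x hx => posFreqDeriv_of_nonpos ρ hx)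
    (fun x hx => posFreqDeriv_of_nonpos ρ hx) hξ

/-- The symbol of `F'` is `O(ξ)` and lives on positive frequencies, so its self-convolution is an
integral of size `O(ξ²)` over `(0, ξ)`. Any rate better than linear would do for the momentum
identity. -/
lemma exists_norm_fourier_hardyDeriv_sq_le (h : IsRegularDensity ρ ρ₁ ρ₂) :
    ∃ C, ∀ ξ : ℝ, 0 ≤ ξ → ‖𝓕 (fun x => hardyDeriv ρ x ^ 2) ξ‖ ≤ C * ξ ^ 3 := by
  have h0 : 0 ≤ ∫ x, ‖ρ x‖ := integral_nonneg fun _ => norm_nonneg _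
  have hpi := Real.pi_pos
  refine ⟨(2 * Real.pi * (2 * ∫ x, ‖ρ x‖)) ^ 2, fun ξ hξ => ?_⟩
  rw [h.fourier_hardyDeriv_sq]
  refine norm_convolution_le_cube (fun x hx => posFreqDeriv_of_nonpos ρ hx) (fun x => ?_)
    (by positivity) hξ
  rw [norm_posFreqDeriv_eq, mul_right_comm]
  gcongr
  exact h.norm_posFreq_le_integral x

/-- A Hardy function with vanishing real part vanishes: here for `F' - (i / 2) F ^ 2`. -/
lemma hardyDeriv_eq_of_re_eq (h : IsRegularDensity ρ ρ₁ ρ₂)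
    (hre : ∀ x, (hardyDeriv ρ x).re = (Complex.I / 2 * hardyPart ρ x ^ 2).re) (x : ℝ) :
    hardyDeriv ρ x = Complex.I / 2 * hardyPart ρ x ^ 2 := by
  obtain ⟨hc, hi, he⟩ := h.convolution_posFreq
  set b := posFreq ρ ⋆[ContinuousLinearMap.mul ℂ ℂ] posFreq ρ with hb
  set k : ℝ → ℂ := fun ξ => posFreqDeriv ρ ξ + -(Complex.I / 2) * b ξ with hk
  have hkc : Continuous k := h.continuous_posFreqDeriv.add (continuous_const.mul hc)
  have hki : Integrable k := h.integrable_posFreqDeriv.add (hi.const_mul _)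
  have hk0 : ∀ ξ ≤ 0, k ξ = 0 := fun ξ hξ => by
    simp only [hk]
    rw [posFreqDeriv_of_nonpos ρ hξ, hb, convolution_eq_zero_of_nonpos
      (fun x hx => posFreq_of_nonpos ρ hx) (fun x hx => posFreq_of_nonpos ρ hx) hξ]
    simp
  have hK : ∀ x, 𝓕⁻ k x = hardyDeriv ρ x - Complex.I / 2 * hardyPart ρ x ^ 2 := fun x => by
    rw [hk, fourierInv_add h.integrable_posFreqDeriv (hi.const_mul _), fourierInv_const_mul, he,
      hardyDeriv]
    ring
  have hki' : Integrable fun ξ => starRingEnd ℂ (k (-ξ)) :=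
    Complex.conjCLE.toContinuousLinearMap.integrable_comp hki.comp_neg
  -- The two terms have disjoint supports in positive and negative frequencies, and their sum is the
  -- symbol of twice the real part. If that is zero, so is `k`.
  have hz : 𝓕⁻ (fun ξ => k ξ + starRingEnd ℂ (k (-ξ))) = fun _ => 0 := by
    ext x
    rw [fourierInv_add hki hki', ← conj_fourierInv, Complex.add_conj, hK, Complex.sub_re, hre]
    simp
  have hcont : Continuous fun ξ => k ξ + starRingEnd ℂ (k (-ξ)) :=
    hkc.add (Complex.continuous_conj.comp (hkc.comp continuous_neg))
  have hinv := fourier_fourierInv_eq_self hcont (hki.add hki')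
    (by rw [hz]; exact integrable_zero _ _ _)
  have hkz : ∀ ξ, k ξ = 0 := by
    intro ξ
    rcases le_or_gt ξ 0 with h0 | h0
    · exact hk0 ξ h0
    · have := congrFun hinv ξ
      rw [hz, Real.fourier_real_eq_integral_exp_smul] at this
      simp only [smul_zero, integral_zero, hk0 (-ξ) (by linarith), map_zero, add_zero] at this
      exact this.symm
  have h1 := hK x
  have h2 : k = fun _ => 0 := funext hkz
  rw [h2, Real.fourierInv_eq_fourier_neg, Real.fourier_real_eq_integral_exp_smul] at h1
  simp only [smul_zero, integral_zero] at h1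
  linear_combination -h1

end IsRegularDensity

/-! ### Classical profiles -/

/-- The density `|Q|²`, as a complex-valued function. -/
noncomputable def density (Q : ℝ → ℂ) (x : ℝ) : ℂ := Q x * starRingEnd ℂ (Q x)

/-- A classical solution `Q` with derivative `q` of the profile equation
`Q'' + (D + |D|)(|Q|²) Q = μ Q`. -/
structure IsProfile (μ : ℝ) (Q q : ℝ → ℂ) : Prop where
  hasDerivAt : ∀ x, HasDerivAt Q (q x) x
  hasDerivAt' : ∀ x, HasDerivAt q (μ * Q x + Complex.I * hardyDeriv (density Q) x * Q x) x
  memLp : MemLp Q 2 volume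
  memLp' : MemLp q 2 volume
  isRegularDensity : ∃ ρ₂, IsRegularDensity (density Q)
    (fun x => q x * starRingEnd ℂ (Q x) + Q x * starRingEnd ℂ (q x)) ρ₂

lemma hasDerivAt_conj {f : ℝ → ℂ} {f' : ℂ} {x : ℝ} (h : HasDerivAt f f' x) :
    HasDerivAt (fun x => starRingEnd ℂ (f x)) (starRingEnd ℂ f') x :=
  h.star

lemma memLp_conj {f : ℝ → ℂ} (hf : MemLp f 2 volume) :
    MemLp (fun x => starRingEnd ℂ (f x)) 2 volume :=
  hf.star

lemma integrable_mul_of_memLp {f g : ℝ → ℂ} (hf : MemLp f 2 volume) (hg : MemLp g 2 volume) :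
    Integrable (fun x => f x * g x) :=
  hf.integrable_mul hg

lemma integrable_conj {f : ℝ → ℂ} (hf : Integrable f) :
    Integrable (fun x => starRingEnd ℂ (f x)) :=
  Complex.conjCLE.toContinuousLinearMap.integrable_comp hf

lemma memLp_bdd_mul {f g : ℝ → ℂ} (hg : MemLp g 2 volume) (hf : AEStronglyMeasurable f volume)
    {C : ℝ} (hC : ∀ x, ‖f x‖ ≤ C) : MemLp (fun x => f x * g x) 2 volume := by
  refine (hg.const_mul (C : ℂ)).mono (hf.mul hg.1) (ae_of_all _ fun x => ?_)
  rw [norm_mul, norm_mul, Complex.norm_real]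
  exact mul_le_mul_of_nonneg_right ((hC x).trans (le_abs_self C)) (norm_nonneg _)

lemma norm_density (Q : ℝ → ℂ) (x : ℝ) : ‖density Q x‖ = ‖Q x‖ ^ 2 := by
  rw [density, norm_mul, RCLike.norm_conj, sq]

lemma density_eq (Q : ℝ → ℂ) (x : ℝ) : density Q x = ((‖Q x‖ ^ 2 : ℝ) : ℂ) := by
  rw [density, Complex.mul_conj, Complex.normSq_eq_norm_sq]

lemma exists_norm_le_of_density {Q ρ₁ : ℝ → ℂ} (h : IsPrimitive (density Q) ρ₁)
    (hi : Integrable ρ₁) : ∃ C, ∀ x, ‖Q x‖ ≤ C := by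
  obtain ⟨C, hC⟩ := h.exists_norm_le hi
  refine ⟨Real.sqrt C, fun x => Real.le_sqrt_of_sq_le ?_⟩
  rw [← norm_density]
  exact hC x

/-- A weak solution of the profile equation in `H¹(ℝ)` is a classical one. -/
lemma exists_isProfile {f g : ℝ → ℂ} {μ : ℝ} (hf : MemLp f 2 volume) (hg : MemLp g 2 volume)
    (h1 : IsWeakDeriv f g)
    (h2 : IsWeakDeriv g (fun x => μ * f x - DAddAbsD (fun z => ((‖f z‖ ^ 2 : ℝ) : ℂ)) x * f x)) :
    ∃ Q q, f =ᵐ[volume] Q ∧ IsProfile μ Q q := by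
  set N : ℝ → ℂ := fun x => DAddAbsD (fun z => ((‖f z‖ ^ 2 : ℝ) : ℂ)) x with hN
  -- `DAddAbsD` takes values in `L²` by construction, even off its domain, so regularity can start
  -- before the nonlocal term is identified.
  have hNL : MemLp N 2 volume := Lp.memLp _
  have lf := hf.locallyIntegrable one_le_two
  have lg := hg.locallyIntegrable one_le_two
  have lh : LocallyIntegrable (fun x => μ * f x - N x * f x) volume := by
    refine LocallyIntegrable.sub ?_ (integrable_mul_of_memLp hNL hf).locallyIntegrable
    exact (hf.const_mul (μ : ℂ)).locallyIntegrable one_le_two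
  obtain ⟨q, hq, hgq⟩ := h2.exists_isPrimitive lg lh
  obtain ⟨Q, hQ, hfQ⟩ := h1.exists_isPrimitive lf lg
  replace hQ := hQ.congr_ae hgq
  have hQL : MemLp Q 2 volume := (memLp_congr_ae hfQ).1 hf
  have hqL : MemLp q 2 volume := (memLp_congr_ae hgq).1 hg
  set h : ℝ → ℂ := fun x => μ * Q x - N x * Q x with hh
  replace hq : IsPrimitive q h := hq.congr_ae (hfQ.mono fun x hx => by simp only [hh, hx])
  have hρ : IsPrimitive (density Q)
      (fun x => q x * starRingEnd ℂ (Q x) + Q x * starRingEnd ℂ (q x)) := hQ.mul hQ.star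
  have hρ1 := (hq.mul hQ.star).add (hQ.mul hq.star)
  have iQ := integrable_mul_of_memLp hQL (memLp_conj hQL)
  have iqQ := integrable_mul_of_memLp hqL (memLp_conj hQL)
  have iQq := integrable_mul_of_memLp hQL (memLp_conj hqL)
  -- Bootstrap: `|Q|²` has an integrable derivative, so `Q` is bounded and `q' = h` is in `L²`; the
  -- same argument for `|q|²` then bounds `q`, which puts the second derivative of the density in
  -- `L²`.
  obtain ⟨C, hC⟩ := exists_norm_le_of_density hρ (iqQ.add iQq)
  have hhL : MemLp h 2 volume := by
    refine (hQL.const_mul (μ : ℂ)).sub ?_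
    refine (memLp_congr_ae (ae_of_all _ fun x => ?_)).1
      (memLp_bdd_mul hNL hQ.continuous.aestronglyMeasurable hC)
    ring
  have iqq := integrable_mul_of_memLp hqL (memLp_conj hqL)
  have ihq := integrable_mul_of_memLp hhL (memLp_conj hqL)
  have iqh := integrable_mul_of_memLp hqL (memLp_conj hhL)
  have ihQ := integrable_mul_of_memLp hhL (memLp_conj hQL)
  have iQh := integrable_mul_of_memLp hQL (memLp_conj hhL)
  obtain ⟨C', hC'⟩ := exists_norm_le_of_density (hq.mul hq.star) (ihq.add iqh)
  have cQ' : ∀ x, ‖starRingEnd ℂ (Q x)‖ ≤ C := fun x => by rw [RCLike.norm_conj]; exact hC x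
  have mQ := hQ.continuous.aestronglyMeasurable (μ := volume)
  have mq := hq.continuous.aestronglyMeasurable (μ := volume)
  have mQ' := hQ.star.continuous.aestronglyMeasurable (μ := volume)
  have qq := memLp_bdd_mul (memLp_conj hqL) mq hC'
  have hreg : IsRegularDensity (density Q)
      (fun x => q x * starRingEnd ℂ (Q x) + Q x * starRingEnd ℂ (q x)) _ :=
    { isPrimitive := hρ
      isPrimitive' := hρ1
      conj_eq := fun x => by rw [density, map_mul, Complex.conj_conj, mul_comm]
      integrable := iQ
      integrable₁ := iqQ.add iQq
      integrable₂ := (ihQ.add iqq).add (iqq.add iQh)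
      memLp := memLp_bdd_mul (memLp_conj hQL) mQ hC
      memLp₂ := by
        refine MemLp.add (MemLp.add ?_ qq) (qq.add (memLp_bdd_mul (memLp_conj hhL) mQ hC))
        simpa only [mul_comm] using memLp_bdd_mul hhL mQ' cQ' }
  refine ⟨Q, q, hfQ, hQ.hasDerivAt hq.continuous, ?_, hQL, hqL, _, hreg⟩
  refine (hq.congr_ae ?_).hasDerivAt ?_
  · have hNe := hreg.dAddAbsD_ae_eq (f := fun z => ((‖f z‖ ^ 2 : ℝ) : ℂ))
      (hfQ.mono fun x hx => by simp only [density_eq, hx])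
    filter_upwards [hNe] with x hx
    simp only [hh, hN]
    rw [hx]
    ring
  · exact (continuous_const.mul hQ.continuous).add
      ((continuous_const.mul hreg.continuous_hardyDeriv).mul hQ.continuous)

/-- An integrable function with vanishing integral. -/
def HasZeroIntegral (f : ℝ → ℂ) : Prop := Integrable f ∧ ∫ x, f x = 0

namespace HasZeroIntegral

variable {f g : ℝ → ℂ}

lemma add (hf : HasZeroIntegral f) (hg : HasZeroIntegral g) :
    HasZeroIntegral fun x => f x + g x :=
  ⟨hf.1.add hg.1, by rw [integral_add hf.1 hg.1, hf.2, hg.2, add_zero]⟩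

lemma const_mul (c : ℂ) (hf : HasZeroIntegral f) : HasZeroIntegral fun x => c * f x :=
  ⟨hf.1.const_mul c, by rw [integral_const_mul, hf.2, mul_zero]⟩

lemma conj (hf : HasZeroIntegral f) : HasZeroIntegral fun x => starRingEnd ℂ (f x) :=
  ⟨integrable_conj hf.1, by rw [integral_conj, hf.2, map_zero]⟩

end HasZeroIntegral

/-! ### Conservation laws, vanishing energy and the Riccati equation. -/

namespace IsProfile

variable {μ : ℝ} {Q q : ℝ → ℂ}

lemma continuous (h : IsProfile μ Q q) : Continuous Q :=
  continuous_iff_continuousAt.2 fun x => (h.hasDerivAt x).continuousAt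

lemma continuous' (h : IsProfile μ Q q) : Continuous q :=
  continuous_iff_continuousAt.2 fun x => (h.hasDerivAt' x).continuousAt

lemma hardyPart_add_conj (h : IsProfile μ Q q) (x : ℝ) :
    hardyPart (density Q) x + starRingEnd ℂ (hardyPart (density Q) x) =
      2 * (Q x * starRingEnd ℂ (Q x)) := by
  obtain ⟨ρ₂, hr⟩ := h.isRegularDensity
  exact hr.hardyPart_add_conj x

lemma hardyDeriv_add_conj (h : IsProfile μ Q q) (x : ℝ) :
    hardyDeriv (density Q) x + starRingEnd ℂ (hardyDeriv (density Q) x) =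
      2 * (q x * starRingEnd ℂ (Q x) + Q x * starRingEnd ℂ (q x)) := by
  obtain ⟨ρ₂, hr⟩ := h.isRegularDensity
  have h1 := (hr.hasDerivAt_hardyPart x).add (hasDerivAt_conj (hr.hasDerivAt_hardyPart x))
  have h2 := ((h.hasDerivAt x).mul (hasDerivAt_conj (h.hasDerivAt x))).const_mul (2 : ℂ)
  refine h1.unique (h2.congr_of_eventuallyEq (Eventually.of_forall fun y => ?_))
  exact h.hardyPart_add_conj y

lemma integrable_density_sq (h : IsProfile μ Q q) : Integrable (fun x => density Q x ^ 2) := by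
  obtain ⟨ρ₂, hr⟩ := h.isRegularDensity
  exact (integrable_mul_of_memLp hr.memLp hr.memLp).congr (ae_of_all _ fun x => (sq _).symm)

lemma integrable_density_cube (h : IsProfile μ Q q) : Integrable (fun x => density Q x ^ 3) := by
  obtain ⟨ρ₂, hr⟩ := h.isRegularDensity
  obtain ⟨C, hC⟩ := hr.isPrimitive.exists_norm_le hr.integrable₁
  exact (h.integrable_density_sq.bdd_mul hr.isPrimitive.continuous.aestronglyMeasurable
    (ae_of_all _ hC)).congr (ae_of_all _ fun x => by simp only; ring)

/-- The current of a profile. -/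
lemma current_eq (h : IsProfile μ Q q) (x : ℝ) :
    starRingEnd ℂ (Q x) * q x - Q x * starRingEnd ℂ (q x) = Complex.I * density Q x ^ 2 := by
  -- The derivative of the current is `i (F' + F̄') ρ = 2i ρ' ρ`, the derivative of `i ρ²`. The
  -- difference is constant and integrable, hence zero.
  have hd : ∀ x, HasDerivAt (fun x => starRingEnd ℂ (Q x) * q x - Q x * starRingEnd ℂ (q x) -
      Complex.I * density Q x ^ 2) 0 x := by
    intro x
    have a1 := h.hasDerivAt x
    have a2 := hasDerivAt_conj a1
    have a3 := h.hasDerivAt' x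
    have a4 := hasDerivAt_conj a3
    have := ((a2.mul a3).sub (a1.mul a4)).sub (((a1.mul a2).pow 2).const_mul Complex.I)
    refine this.congr_deriv ?_
    simp only [map_add, map_mul, Complex.conj_I, Complex.conj_ofReal, Pi.mul_apply]
    linear_combination (Complex.I * Q x * starRingEnd ℂ (Q x)) * h.hardyDeriv_add_conj x
  have hi : Integrable (fun x => starRingEnd ℂ (Q x) * q x - Q x * starRingEnd ℂ (q x) -
      Complex.I * density Q x ^ 2) :=
    ((integrable_mul_of_memLp (memLp_conj h.memLp) h.memLp').sub
      (integrable_mul_of_memLp h.memLp (memLp_conj h.memLp'))).sub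
      (h.integrable_density_sq.const_mul _)
  have hP : IsPrimitive _ (fun _ => (0 : ℂ)) := IsPrimitive.of_hasDerivAt hd continuous_const
  have ht := hP.tendsto_atTop hi (integrable_zero _ _ _)
  have hconst : ∀ y, starRingEnd ℂ (Q y) * q y - Q y * starRingEnd ℂ (q y) -
      Complex.I * density Q y ^ 2 = starRingEnd ℂ (Q x) * q x - Q x * starRingEnd ℂ (q x) -
      Complex.I * density Q x ^ 2 := fun y => by
    have := hP.integral_eq x y
    simp only [intervalIntegral.integral_zero] at this
    exact (sub_eq_zero.1 this.symm)
  simp only [hconst] at ht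
  exact sub_eq_zero.1 (tendsto_nhds_unique tendsto_const_nhds ht)

/-- The flux of momentum. -/
noncomputable def momentumFlux (μ : ℝ) (Q q : ℝ → ℂ) (x : ℝ) : ℂ :=
  q x * starRingEnd ℂ (q x) - density Q x ^ 3 / 3 - μ * density Q x

lemma integrable_momentumFlux (h : IsProfile μ Q q) : Integrable (momentumFlux μ Q q) :=
  ((integrable_mul_of_memLp h.memLp' (memLp_conj h.memLp')).sub
    (h.integrable_density_cube.div_const 3)).sub
    ((integrable_mul_of_memLp h.memLp (memLp_conj h.memLp)).const_mul _)

/-- Writing `Q̄ q` through its sum `ρ'` and difference `i ρ²` with its conjugate, the terms in `μ`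
and in `ρ² ρ'` cancel. What remains is `(i/2)(F' - F̄') ρ'`, and `2ρ' = F' + F̄'`. -/
lemma isPrimitive_momentumFlux (h : IsProfile μ Q q) :
    IsPrimitive (momentumFlux μ Q q) (fun x => Complex.I / 4 * (hardyDeriv (density Q) x ^ 2 -
      starRingEnd ℂ (hardyDeriv (density Q) x ^ 2))) := by
  obtain ⟨ρ₂, hr⟩ := h.isRegularDensity
  refine IsPrimitive.of_hasDerivAt (fun x => ?_) ?_
  · have a1 := h.hasDerivAt x
    have a2 := hasDerivAt_conj a1
    have a3 := h.hasDerivAt' x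
    have a4 := hasDerivAt_conj a3
    have := ((a3.mul a4).sub (((a1.mul a2).pow 3).div_const 3)).sub
      ((a1.mul a2).const_mul (μ : ℂ))
    refine this.congr_deriv ?_
    have hj := h.current_eq x
    have hb := h.hardyDeriv_add_conj x
    rw [density] at hj
    simp only [map_add, map_mul, map_pow, Complex.conj_I, Complex.conj_ofReal, Pi.mul_apply]
    set F := hardyDeriv (density Q) x
    set F' := starRingEnd ℂ F
    set P := Q x
    set P' := starRingEnd ℂ P
    set p := q x
    set p' := starRingEnd ℂ p
    linear_combination (-Complex.I / 2 * (F + F')) * hj + (-Complex.I / 4 * (F - F')) * hb +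
      ((P * P') ^ 2 * (-1 / 2) * (F + F')) * Complex.I_sq + ((P * P') ^ 2 / 2) * hb
  · have hc := hr.continuous_hardyDeriv.pow 2
    exact continuous_const.mul (hc.sub (Complex.continuous_conj.comp hc))

/-- The momentum identity. -/
lemma integral_momentumFlux (h : IsProfile μ Q q) : ∫ x, momentumFlux μ Q q x = 0 := by
  obtain ⟨ρ₂, hr⟩ := h.isRegularDensity
  have hS := h.integrable_momentumFlux
  have hG := hr.integrable_hardyDeriv_sq
  have hG' := integrable_conj hG
  obtain ⟨C, hC⟩ := hr.exists_norm_fourier_hardyDeriv_sq_le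
  have hpi := Real.pi_pos
  -- The conjugate of `F'²` has no positive frequencies, so `2πiξ Ŝ(ξ)` is `i/4` times the transform
  -- of `F'²`; dividing the cubic bound by `ξ` leaves a quadratic one.
  have hb : ∀ ξ : ℝ, 0 < ξ → ‖𝓕 (momentumFlux μ Q q) ξ‖ ≤ C * ξ ^ 2 := by
    intro ξ hξ
    have h1 := h.isPrimitive_momentumFlux.fourier_eq hS ((hG.sub hG').const_mul _) ξ
    have h2 : 𝓕 (fun x => Complex.I / 4 * (hardyDeriv (density Q) x ^ 2 -
        starRingEnd ℂ (hardyDeriv (density Q) x ^ 2)) : ℝ → ℂ) ξ =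
        Complex.I / 4 * 𝓕 (fun x : ℝ => hardyDeriv (density Q) x ^ 2) ξ := by
      have e1 : ∀ f : ℝ → ℂ, 𝓕 f ξ = 𝓕⁻ f (-ξ) := fun f => by
        rw [Real.fourierInv_eq_fourier_neg, neg_neg]
      rw [e1, IsRegularDensity.fourierInv_const_mul]
      have e2 : (fun x : ℝ => hardyDeriv (density Q) x ^ 2 -
          starRingEnd ℂ (hardyDeriv (density Q) x ^ 2)) = fun x => hardyDeriv (density Q) x ^ 2 +
          (-1 : ℂ) * starRingEnd ℂ (hardyDeriv (density Q) x ^ 2) := by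
        ext x
        ring
      rw [e2, IsRegularDensity.fourierInv_add hG (hG'.const_mul _),
        IsRegularDensity.fourierInv_const_mul, ← e1, ← e1, fourier_conj,
        hr.fourier_hardyDeriv_sq_of_nonpos (ξ := -ξ) (by linarith)]
      simp
    rw [h2] at h1
    have h3 := congrArg norm h1
    simp only [norm_mul, norm_div, Complex.norm_I, Complex.norm_ofNat, Complex.norm_real,
      Real.norm_eq_abs, abs_of_pos hpi, abs_of_pos hξ] at h3
    have h4 := hC ξ hξ.le
    have h5 : ξ * (2 * Real.pi * ‖𝓕 (momentumFlux μ Q q) ξ‖) ≤ ξ * (1 / 4 * (C * ξ ^ 2)) := by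
      linarith
    have h6 := le_of_mul_le_mul_left h5 hξ
    have h7 := Real.pi_gt_three
    nlinarith [norm_nonneg (𝓕 (momentumFlux μ Q q) ξ)]
  have hlim : Tendsto (fun ξ => ‖𝓕 (momentumFlux μ Q q) ξ‖) (𝓝[>] (0 : ℝ))
      (𝓝 ‖𝓕 (momentumFlux μ Q q) 0‖) :=
    ((continuous_fourier hS).norm.tendsto 0).mono_left nhdsWithin_le_nhds
  have hlim' : Tendsto (fun ξ : ℝ => C * ξ ^ 2) (𝓝[>] (0 : ℝ)) (𝓝 0) := by
    have : Continuous fun ξ : ℝ => C * ξ ^ 2 := by fun_prop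
    simpa using (this.tendsto 0).mono_left nhdsWithin_le_nhds
  have h0 : ‖𝓕 (momentumFlux μ Q q) 0‖ ≤ 0 :=
    le_of_tendsto_of_tendsto hlim hlim' (eventually_mem_nhdsWithin.mono fun ξ hξ => hb ξ hξ)
  have h1 := norm_le_zero_iff.1 h0
  rw [Real.fourier_real_eq_integral_exp_smul] at h1
  simpa using h1

/-- The energy of a profile vanishes, so that the profile satisfies the first order equation
`Q' = i Π₊(|Q|²) Q`. -/
lemma deriv_eq (h : IsProfile μ Q q) (x : ℝ) :
    q x = Complex.I / 2 * hardyPart (density Q) x * Q x := by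
  obtain ⟨ρ₂, hr⟩ := h.isRegularDensity
  obtain ⟨iF3, zF3⟩ := hr.integral_hardyPart_cube
  set F := hardyPart (density Q) with hF
  set F₁ := hardyDeriv (density Q) with hF₁
  have hcF : Continuous F := hr.continuous_hardyPart
  have hcF₁ : Continuous F₁ := hr.continuous_hardyDeriv
  have iqq := integrable_mul_of_memLp h.memLp' (memLp_conj h.memLp')
  have iρ := integrable_mul_of_memLp h.memLp (memLp_conj h.memLp)
  have iS := h.integrable_momentumFlux
  set T : ℝ → ℂ := fun x => (μ * Q x + Complex.I * F₁ x * Q x) * starRingEnd ℂ (Q x) +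
    q x * starRingEnd ℂ (q x) with hT
  set W : ℝ → ℂ := fun x => F₁ x * density Q x +
    F x * (q x * starRingEnd ℂ (Q x) + Q x * starRingEnd ℂ (q x)) with hW
  have cQ' : Continuous fun x => starRingEnd ℂ (Q x) := Complex.continuous_conj.comp h.continuous
  have cq' : Continuous fun x => starRingEnd ℂ (q x) := Complex.continuous_conj.comp h.continuous'
  have hQ := h.continuous
  have hq := h.continuous'
  have iF₁ρ : Integrable fun x => F₁ x * density Q x :=
    iρ.bdd_mul hcF₁.aestronglyMeasurable (ae_of_all _ (IsRegularDensity.norm_hardyDeriv_le _))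
  have iFρ : Integrable fun x => F x * density Q x :=
    iρ.bdd_mul hcF.aestronglyMeasurable (ae_of_all _ (IsRegularDensity.norm_hardyPart_le _))
  have iT : Integrable T := by
    refine Integrable.add ?_ iqq
    refine ((iρ.const_mul (μ : ℂ)).add (iF₁ρ.const_mul Complex.I)).congr (ae_of_all _ fun x => ?_)
    simp only [Pi.add_apply, density]
    ring
  have iW : Integrable W :=
    iF₁ρ.add (hr.integrable₁.bdd_mul hcF.aestronglyMeasurable
      (ae_of_all _ (IsRegularDensity.norm_hardyPart_le _)))
  have zT : ∫ x, T x = 0 :=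
    (IsPrimitive.of_hasDerivAt (fun x => (h.hasDerivAt' x).mul (hasDerivAt_conj (h.hasDerivAt x)))
      (by rw [← hF₁]; fun_prop)).integral_eq_zero
      (integrable_mul_of_memLp h.memLp' (memLp_conj h.memLp)) iT
  have zW : ∫ x, W x = 0 :=
    (IsPrimitive.mul (IsPrimitive.of_hasDerivAt hr.hasDerivAt_hardyPart hcF₁)
      hr.isPrimitive).integral_eq_zero iFρ iW
  have zS := h.integral_momentumFlux
  -- `T = (q Q̄)'` and `W = (F ρ)'`. The flux and `T` share the kinetic term and cancel in `μ`; `W`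
  -- cancels the `F'` terms of `T`; the cubes of `F` supply `|F|² ρ`, since `F + F̄ = 2ρ`.
  have key : ∀ x, (q x - Complex.I / 2 * F x * Q x) *
      starRingEnd ℂ (q x - Complex.I / 2 * F x * Q x) =
      1 / 2 * momentumFlux μ Q q x + (1 / 4 * T x + (1 / 4 * starRingEnd ℂ (T x) +
      (-Complex.I / 4 * W x + (Complex.I / 4 * starRingEnd ℂ (W x) +
      (-1 / 24 * F x ^ 3 + -1 / 24 * starRingEnd ℂ (F x ^ 3)))))) := by
    intro x
    have hj := h.current_eq x
    have ha := h.hardyPart_add_conj x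
    simp only [hT, hW, momentumFlux, density, map_sub, map_add, map_mul, map_pow, map_div₀,
      Complex.conj_I, Complex.conj_ofReal, Complex.conj_conj, Complex.conj_ofNat] at hj ⊢
    rw [← hF] at ha
    set E := F x
    set E' := starRingEnd ℂ E
    set G := F₁ x
    set G' := starRingEnd ℂ G
    set P := Q x
    set P' := starRingEnd ℂ P
    set p := q x
    set p' := starRingEnd ℂ p
    have e1 : E' = 2 * (P * P') - E := by linear_combination ha
    have e2 : P' * p = P * p' + Complex.I * (P * P') ^ 2 := by linear_combination hj
    rw [e1]
    linear_combination (Complex.I / 2 * (P * P')) * e2 +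
      (- (P * P') * (2 * (P * P') - E) * E / 4 + (P * P') ^ 3 / 2) * Complex.I_sq
  have zT' : HasZeroIntegral T := ⟨iT, zT⟩
  have zW' : HasZeroIntegral W := ⟨iW, zW⟩
  have zF : HasZeroIntegral fun x => F x ^ 3 := ⟨iF3, zF3⟩
  have zS' : HasZeroIntegral (momentumFlux μ Q q) := ⟨iS, zS⟩
  obtain ⟨hi, hz⟩ := (HasZeroIntegral.const_mul (1 / 2) zS').add ((HasZeroIntegral.const_mul (1 / 4) zT').add
    ((HasZeroIntegral.const_mul (1 / 4) zT'.conj).add ((HasZeroIntegral.const_mul (-Complex.I / 4) zW').add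
    ((HasZeroIntegral.const_mul (Complex.I / 4) zW'.conj).add ((HasZeroIntegral.const_mul (-1 / 24) zF).add
    (HasZeroIntegral.const_mul (-1 / 24) zF.conj))))))
  simp only [← key] at hi hz
  set A : ℝ → ℂ := fun x => q x - Complex.I / 2 * F x * Q x with hA
  have hAc : Continuous A := by fun_prop
  have e : ∀ x, A x * starRingEnd ℂ (A x) = ((‖A x‖ ^ 2 : ℝ) : ℂ) := fun x => density_eq A x
  change ∫ x, A x * starRingEnd ℂ (A x) = 0 at hz
  replace hi : Integrable fun x => A x * starRingEnd ℂ (A x) := hi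
  simp only [e] at hz hi
  rw [integral_complex_ofReal, Complex.ofReal_eq_zero] at hz
  have hi' : Integrable fun x => ‖A x‖ ^ 2 := by
    simpa only [Complex.ofReal_re] using! hi.re
  have h0 := (integral_eq_zero_iff_of_nonneg (fun x => by positivity) hi').1 hz
  have h1 := (Continuous.ae_eq_iff_eq volume (by fun_prop) continuous_const).1 h0
  have h2 : ‖A x‖ ^ 2 = 0 := congrFun h1 x
  have h3 : A x = 0 := norm_eq_zero.1 (pow_eq_zero_iff two_ne_zero |>.1 h2)
  exact sub_eq_zero.1 h3

/-- The Riccati equation for `2 Π₊(|Q|²)`. -/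
lemma hardyDeriv_eq (h : IsProfile μ Q q) (x : ℝ) :
    hardyDeriv (density Q) x = Complex.I / 2 * hardyPart (density Q) x ^ 2 := by
  obtain ⟨ρ₂, hr⟩ := h.isRegularDensity
  refine hr.hardyDeriv_eq_of_re_eq (fun y => ?_) x
  -- Both real parts equal `(i/2)(F - F̄) ρ`: the left one by `Re F' = ρ'` and the first order
  -- equation, the right one by `2ρ = F + F̄`.
  have hb := h.hardyDeriv_add_conj y
  have ha := h.hardyPart_add_conj y
  have hq := h.deriv_eq y
  have hq' := congrArg (starRingEnd ℂ) hq
  simp only [map_mul, map_div₀, Complex.conj_I, Complex.conj_ofNat] at hq'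
  have e : ∀ z : ℂ, (z.re : ℂ) = (z + starRingEnd ℂ z) / 2 := fun z => by
    rw [Complex.add_conj]
    push_cast
    ring
  apply Complex.ofReal_injective
  rw [e, e, hb, hq', hq]
  simp only [map_mul, map_div₀, map_pow, Complex.conj_I, Complex.conj_ofNat]
  set E := hardyPart (density Q) y
  set E' := starRingEnd ℂ E
  linear_combination (-Complex.I / 4 * (E - E')) * ha

end IsProfile

/-! ### Solution of the first order system -/

/-- Integrating factor. The coefficient `a` may itself involve the unknown, which is how the Riccati
equation is solved below. -/
lemma eq_zero_of_hasDerivAt_mul {W a : ℝ → ℂ} (ha : Continuous a)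
    (hW : ∀ x, HasDerivAt W (a x * W x) x) {x₀ : ℝ} (h0 : W x₀ = 0) (x : ℝ) : W x = 0 := by
  have hd : ∀ x, HasDerivAt (fun x => W x * Complex.exp (-∫ t in x₀..x, a t)) 0 x := by
    intro x
    have h1 := (intervalIntegral.integral_hasDerivAt_right (ha.intervalIntegrable x₀ x)
      (ha.stronglyMeasurableAtFilter _ _) ha.continuousAt).neg.cexp
    refine ((hW x).mul h1).congr_deriv ?_
    ring
  have hc := is_const_of_deriv_eq_zero (fun x => (hd x).differentiableAt)
    (fun x => (hd x).deriv) x x₀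
  simp only [h0, zero_mul] at hc
  exact (mul_eq_zero.1 hc).resolve_right (Complex.exp_ne_zero _)

/-- Nontrivial profiles exist only for `μ = 0`, and they are explicit rational functions. -/
theorem IsProfile.exists_eq_div {μ : ℝ} {Q q : ℝ → ℂ} (h : IsProfile μ Q q) {x₀ : ℝ}
    (hx₀ : Q x₀ ≠ 0) :
    μ = 0 ∧ ∃ κ c : ℂ, 0 < c.im ∧ ‖κ‖ ^ 2 = 2 * c.im ∧ ∀ x : ℝ, Q x = κ / (x + c) := by
  obtain ⟨ρ₂, hr⟩ := h.isRegularDensity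
  set F := hardyPart (density Q) with hF
  have hFc : Continuous F := hr.continuous_hardyPart
  have hFd : ∀ x, HasDerivAt F (Complex.I / 2 * F x ^ 2) x := fun x => by
    rw [hF, ← h.hardyDeriv_eq]
    exact hr.hasDerivAt_hardyPart x
  have hQd : ∀ x, HasDerivAt Q (Complex.I / 2 * F x * Q x) x := fun x => by
    rw [hF, ← h.deriv_eq]
    exact h.hasDerivAt x
  set F₀ := F x₀ with hF₀
  have hre : F₀.re = ‖Q x₀‖ ^ 2 := by
    rw [hF₀, hF, hr.hardyPart_re, density_eq, Complex.ofReal_re]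
  have hre0 : 0 < F₀.re := by
    rw [hre]
    have := norm_pos_iff.2 hx₀
    positivity
  have hF₀0 : F₀ ≠ 0 := fun h0 => by
    rw [h0] at hre0
    simp at hre0
  refine ⟨?_, ?_⟩
  -- Differentiating the first order equation and using Riccati gives `Q'' = i F' Q`; comparison
  -- with the profile equation leaves `μ Q = 0`.
  · have h1 := h.hasDerivAt' x₀
    have h2 : HasDerivAt q (Complex.I / 2 * (Complex.I / 2 * F x₀ ^ 2) * Q x₀ +
        Complex.I / 2 * F x₀ * (Complex.I / 2 * F x₀ * Q x₀)) x₀ := by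
      have := ((hFd x₀).const_mul (Complex.I / 2)).mul (hQd x₀)
      refine this.congr_of_eventuallyEq (Eventually.of_forall fun x => ?_)
      exact h.deriv_eq x
    have h3 := h1.unique h2
    rw [h.hardyDeriv_eq, ← hF] at h3
    have h4 : (μ : ℂ) * Q x₀ = 0 := by linear_combination h3
    exact Complex.ofReal_eq_zero.1 ((mul_eq_zero.1 h4).resolve_right hx₀)
  · have hD : ∀ x : ℝ, HasDerivAt (fun x : ℝ => 1 - Complex.I / 2 * F₀ * ((x : ℂ) - x₀))
        (-(Complex.I / 2 * F₀)) x := fun x => by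
      have := (((hasDerivAt_id (x : ℂ)).comp_ofReal.sub_const (x₀ : ℂ)).const_mul
        (Complex.I / 2 * F₀)).const_sub 1
      simpa using this
    -- With `D` the affine factor, `F D - F₀` satisfies the linear equation `W' = (i/2) F W` and
    -- vanishes at `x₀`.
    have e1 : ∀ x : ℝ, F x * (1 - Complex.I / 2 * F₀ * ((x : ℂ) - x₀)) = F₀ := by
      intro x
      refine sub_eq_zero.1 (eq_zero_of_hasDerivAt_mul (a := fun x => Complex.I / 2 * F x)
        (W := fun x : ℝ => F x * (1 - Complex.I / 2 * F₀ * ((x : ℂ) - x₀)) - F₀) (x₀ := x₀)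
        (by fun_prop) (fun x => ?_) (by simp [hF₀]) x)
      refine (((hFd x).mul (hD x)).sub_const F₀).congr_deriv ?_
      ring
    have e2 : ∀ x : ℝ, Q x * (1 - Complex.I / 2 * F₀ * ((x : ℂ) - x₀)) = Q x₀ := by
      intro x
      have hd : ∀ x, HasDerivAt
          (fun x : ℝ => Q x * (1 - Complex.I / 2 * F₀ * ((x : ℂ) - x₀))) 0 x := fun x => by
        refine ((hQd x).mul (hD x)).congr_deriv ?_
        linear_combination (Complex.I / 2 * Q x) * e1 x
      have := is_const_of_deriv_eq_zero (fun x => (hd x).differentiableAt)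
        (fun x => (hd x).deriv) x x₀
      simpa using this
    have hn : Complex.normSq F₀ = ‖F₀‖ ^ 2 := Complex.normSq_eq_norm_sq F₀
    have hnpos : 0 < ‖F₀‖ ^ 2 := by
      have := norm_pos_iff.2 hF₀0
      positivity
    have him : (-(x₀ : ℂ) + 2 * Complex.I / F₀).im = 2 * F₀.re / ‖F₀‖ ^ 2 := by
      rw [← hn]
      simp [Complex.div_im]
    -- The pole `-c` is the zero of the affine factor. Since `Re F₀ = |Q x₀|²`, both `Im c > 0` and
    -- `|κ|² = 2 Im c` follow.
    refine ⟨2 * Complex.I * Q x₀ / F₀, -x₀ + 2 * Complex.I / F₀, ?_, ?_, fun x => ?_⟩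
    · rw [him]
      positivity
    · rw [him, hre]
      simp only [norm_div, norm_mul, Complex.norm_I, Complex.norm_ofNat]
      field_simp
    · have hne : 1 - Complex.I / 2 * F₀ * ((x : ℂ) - x₀) ≠ 0 := fun h0 => by
        have := e1 x
        rw [h0, mul_zero] at this
        exact hF₀0 this.symm
      have e3 : (x : ℂ) + (-x₀ + 2 * Complex.I / F₀) =
          2 * Complex.I / F₀ * (1 - Complex.I / 2 * F₀ * ((x : ℂ) - x₀)) := by
        field_simp
        linear_combination (F₀ * (x - x₀)) * Complex.I_sq
      rw [e3, eq_div_iff (mul_ne_zero (div_ne_zero (by simp) hF₀0) hne)]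
      linear_combination (2 * Complex.I / F₀) * e2 x

/-! ### Explicit solitary waves -/

lemma exists_eq_norm_mul_exp (κ : ℂ) :
    ∃ θ ∈ Ico (0 : ℝ) (2 * Real.pi), κ = ‖κ‖ * Complex.exp (Complex.I * θ) := by
  have h := Complex.norm_mul_exp_arg_mul_I κ
  rcases le_or_gt 0 κ.arg with h0 | h0
  · refine ⟨κ.arg, ⟨h0, ?_⟩, ?_⟩
    · linarith [Complex.arg_le_pi κ, Real.pi_pos]
    · rw [mul_comm Complex.I, h]
  · refine ⟨κ.arg + 2 * Real.pi, ⟨?_, ?_⟩, ?_⟩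
    · linarith [Complex.neg_pi_lt_arg κ, Real.pi_pos]
    · linarith
    · have : Complex.I * ((κ.arg + 2 * Real.pi : ℝ) : ℂ) =
          κ.arg * Complex.I + 2 * Real.pi * Complex.I := by
        push_cast
        ring
      rw [this, Complex.exp_periodic, h]

/-- The scaling `1 / Im c` and shift `Re c / Im c` move the pole `-c` to `-i`; the relation between
`κ` and `c` is precisely what makes the amplitude `√(2 lam)` after this change. -/
lemma exists_eq_groundState {κ c : ℂ} (hc : 0 < c.im) (hκ : ‖κ‖ ^ 2 = 2 * c.im) :
    ∃ θ ∈ Ico (0 : ℝ) (2 * Real.pi), ∃ lam : ℝ, 0 < lam ∧ ∃ y : ℝ, ∀ x : ℝ,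
      κ / (x + c) = Complex.exp (Complex.I * θ) * (Real.sqrt lam : ℂ) *
        groundState (lam * x + y) := by
  obtain ⟨θ, hθ, e⟩ := exists_eq_norm_mul_exp κ
  refine ⟨θ, hθ, c.im⁻¹, inv_pos.2 hc, c.re / c.im, fun x => ?_⟩
  have hc' : (c.im : ℂ) ≠ 0 := Complex.ofReal_ne_zero.2 hc.ne'
  have hxc : (x : ℂ) + c ≠ 0 := fun h0 => by
    have := congrArg Complex.im h0
    simp at this
    exact hc.ne' this
  have e1 : (((c.im⁻¹ * x + c.re / c.im : ℝ) : ℂ) + Complex.I) = (x + c) / c.im := by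
    push_cast
    field_simp
    rw [add_assoc, Complex.re_add_im]
  have e2 : Real.sqrt c.im⁻¹ * Real.sqrt 2 * c.im = ‖κ‖ := by
    rw [← Real.sqrt_mul (inv_nonneg.2 hc.le), ← Real.sqrt_sq (norm_nonneg κ), hκ]
    have : c.im⁻¹ * 2 = 2 * c.im * (c.im⁻¹) ^ 2 := by
      field_simp
    rw [this, Real.sqrt_mul (by positivity), Real.sqrt_sq (inv_nonneg.2 hc.le), mul_assoc,
      inv_mul_cancel₀ hc.ne', mul_one]
  rw [groundState, e1]
  conv_lhs => rw [e, ← e2]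
  push_cast
  field_simp

lemma norm_groundState_sq (x : ℝ) : ‖groundState x‖ ^ 2 = 2 * (1 + x ^ 2)⁻¹ := by
  have h : Complex.normSq ((x : ℂ) + Complex.I) = 1 + x ^ 2 := by
    rw [Complex.normSq_apply]
    simp
    ring
  rw [groundState, norm_div, div_pow, ← Complex.normSq_eq_norm_sq ((x : ℂ) + Complex.I), h,
    Complex.norm_real, Real.norm_of_nonneg (Real.sqrt_nonneg 2), Real.sq_sqrt zero_le_two,
    div_eq_mul_inv]

lemma mass_groundState : mass groundState = 2 * Real.pi := by
  simp only [mass, norm_groundState_sq]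
  rw [integral_const_mul, integral_univ_inv_one_add_sq]

lemma mass_eq_of_ae_eq {f e : ℝ → ℂ} {κ c : ℂ} (hc : 0 < c.im) (hκ : ‖κ‖ ^ 2 = 2 * c.im)
    (he : ∀ x, ‖e x‖ = 1) (hf : f =ᵐ[volume] fun x => e x * (κ / (x + c))) :
    mass f = mass groundState := by
  obtain ⟨θ, -, lam, hlam, y, h⟩ := exists_eq_groundState hc hκ
  have h1 : mass f = ∫ x : ℝ, lam * ‖groundState (lam * x + y)‖ ^ 2 := by
    refine integral_congr_ae (hf.mono fun x hx => ?_)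
    have hexp : ‖Complex.exp (Complex.I * θ)‖ = 1 := by
      rw [mul_comm]
      exact Complex.norm_exp_ofReal_mul_I θ
    simp only
    rw [hx, norm_mul, he, h, norm_mul, norm_mul, hexp, Complex.norm_real,
      Real.norm_of_nonneg (Real.sqrt_nonneg _), one_mul, one_mul, mul_pow, Real.sq_sqrt hlam.le]
  have h2 := Measure.integral_comp_mul_left (fun x => ‖groundState (x + y)‖ ^ 2) lam
  rw [h1, integral_const_mul, h2, integral_add_right_eq_self (fun x => ‖groundState x‖ ^ 2),
    abs_of_pos (inv_pos.2 hlam), smul_eq_mul, mul_inv_cancel_left₀ hlam.ne', mass]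

/-- The symbol of `x ↦ exp (i a x) * (κ / (x + c))`, for `0 < im c`. -/
noncomputable def waveSymbol (a : ℝ) (κ c : ℂ) (ξ : ℝ) : ℂ :=
  (Ioi (a / (2 * Real.pi))).indicator (fun ξ : ℝ => -(2 * Real.pi * Complex.I) * κ *
    Complex.exp (-(Complex.I * a * c)) * Complex.exp (2 * Real.pi * Complex.I * c * ξ)) ξ

section WaveSymbol

variable {a : ℝ} {κ c : ℂ}

lemma re_exponent_neg (hc : 0 < c.im) (x : ℝ) : (2 * Real.pi * Complex.I * (x + c)).re < 0 := by
  have : (2 * Real.pi * Complex.I * (x + c)).re = -(2 * Real.pi * c.im) := by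
    simp
  rw [this]
  have := Real.pi_pos
  have : 0 < 2 * Real.pi * c.im := by positivity
  linarith

lemma integrable_waveSymbol (hc : 0 < c.im) : Integrable (waveSymbol a κ c) := by
  have h := integrableOn_exp_mul_complex_Ioi (re_exponent_neg hc 0) (a / (2 * Real.pi))
  simp only [Complex.ofReal_zero, zero_add] at h
  exact (integrable_indicator_iff measurableSet_Ioi).2 (h.const_mul _)

lemma memLp_waveSymbol (hc : 0 < c.im) : MemLp (waveSymbol a κ c) 2 volume := by
  have hi := integrable_waveSymbol (a := a) (κ := κ) hc
  rw [memLp_two_iff_integrable_sq_norm hi.1]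
  set B : ℝ := ‖-(2 * Real.pi * Complex.I) * κ * Complex.exp (-(Complex.I * a * c))‖ *
    Real.exp (-(c.im * a)) with hB
  have hb : ∀ ξ, ‖waveSymbol a κ c ξ‖ ≤ B := by
    intro ξ
    rw [waveSymbol]
    by_cases h : ξ ∈ Ioi (a / (2 * Real.pi))
    · rw [indicator_of_mem h, norm_mul, hB]
      refine mul_le_mul_of_nonneg_left ?_ (norm_nonneg _)
      rw [Complex.norm_exp, Real.exp_le_exp]
      have : (2 * Real.pi * Complex.I * c * ξ).re = -(c.im * (ξ * (2 * Real.pi))) := by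
        simp
        ring
      rw [this]
      have h2 := (div_lt_iff₀ Real.two_pi_pos).1 (mem_Ioi.1 h)
      nlinarith
    · rw [indicator_of_notMem h, norm_zero]
      positivity
  refine (hi.norm.const_mul B).mono' (hi.1.norm.pow 2) (ae_of_all _ fun ξ => ?_)
  rw [Real.norm_of_nonneg (by positivity), sq]
  exact mul_le_mul_of_nonneg_right (hb ξ) (norm_nonneg _)

/-- An exponential integrated over a half-line; `Im c > 0` gives decay, and modulation by `a` moves
the threshold to `a / 2π`. -/
lemma fourierInv_waveSymbol (hc : 0 < c.im) (x : ℝ) :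
    𝓕⁻ (waveSymbol a κ c) x = Complex.exp (Complex.I * a * x) * (κ / (x + c)) := by
  have hre := re_exponent_neg hc x
  have hpi : (Real.pi : ℂ) ≠ 0 := Complex.ofReal_ne_zero.2 Real.pi_ne_zero
  have hne : (x : ℂ) + c ≠ 0 := fun h0 => by
    rw [h0] at hre
    simp at hre
  have e : ∀ ξ : ℝ, Complex.exp (((-2 * Real.pi * ξ * (-x) : ℝ) : ℂ) * Complex.I) •
      waveSymbol a κ c ξ = (Ioi (a / (2 * Real.pi))).indicator (fun ξ : ℝ =>
        -(2 * Real.pi * Complex.I) * κ * Complex.exp (-(Complex.I * a * c)) *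
        Complex.exp (2 * Real.pi * Complex.I * (x + c) * ξ)) ξ := by
    intro ξ
    rw [waveSymbol]
    by_cases h : ξ ∈ Ioi (a / (2 * Real.pi))
    · rw [indicator_of_mem h, indicator_of_mem h, smul_eq_mul, mul_left_comm, ← Complex.exp_add]
      congr 2
      push_cast
      ring
    · rw [indicator_of_notMem h, indicator_of_notMem h, smul_zero]
  rw [Real.fourierInv_eq_fourier_neg, Real.fourier_real_eq_integral_exp_smul]
  simp only [e]
  rw [integral_indicator measurableSet_Ioi, integral_const_mul, integral_exp_mul_complex_Ioi hre]
  have e2 : 2 * Real.pi * Complex.I * (x + c) * ((a / (2 * Real.pi) : ℝ) : ℂ) =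
      Complex.I * a * x + Complex.I * a * c := by
    push_cast
    field_simp
  rw [e2, Complex.exp_add, Complex.exp_neg]
  have := Complex.exp_ne_zero (Complex.I * a * c)
  field_simp

/-- An explicit wave has nonnegative frequencies only, if and only if its velocity is
nonnegative. -/
lemma memH1Plus_iff {f : ℝ → ℂ} (hf : MemH1 f) (hc : 0 < c.im) (hκ : κ ≠ 0)
    (h : f =ᵐ[volume] fun x => Complex.exp (Complex.I * a * x) * (κ / (x + c))) :
    MemH1Plus f ↔ 0 ≤ a := by
  have hpi := Real.pi_pos
  have hsymb : ∀ hL : MemLp f 2 volume,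
      (𝓕 (hL.toLp f : Lp ℂ 2 (volume : Measure ℝ)) : Lp ℂ 2 volume) =ᵐ[volume]
        waveSymbol a κ c := by
    intro hL
    have hk := memLp_waveSymbol (a := a) (κ := κ) hc
    have e : hL.toLp f = 𝓕⁻ (hk.toLp _ : Lp ℂ 2 (volume : Measure ℝ)) := by
      apply Lp.ext
      refine hL.coeFn_toLp.trans (h.trans ?_)
      refine EventuallyEq.symm ((lpFourierInv_toLp_ae_eq (integrable_waveSymbol hc) hk).trans ?_)
      exact ae_of_all _ fun x => fourierInv_waveSymbol hc x
    rw [e, FourierTransform.fourier_fourierInv_eq]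
    exact hk.coeFn_toLp
  constructor
  · rintro ⟨-, hL, hz⟩
    by_contra ha
    rw [not_le] at ha
    have hlt : a / (2 * Real.pi) < 0 := div_neg_of_neg_of_pos ha (by positivity)
    -- Above its threshold the symbol never vanishes, so for `a < 0` an interval of positive length
    -- would have to be null.
    have hall : ∀ᵐ ξ : ℝ, ξ ∉ Ioo (a / (2 * Real.pi)) 0 := by
      filter_upwards [hz, hsymb hL] with ξ h1 h2 hξ
      have h3 := h1 hξ.2
      rw [h2, waveSymbol, indicator_of_mem (mem_Ioi.2 hξ.1)] at h3
      simp [Complex.exp_ne_zero, hκ, hpi.ne'] at h3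
    rw [ae_iff] at hall
    simp only [not_not] at hall
    have : volume (Ioo (a / (2 * Real.pi)) 0) = 0 := hall
    rw [Real.volume_Ioo, ENNReal.ofReal_eq_zero] at this
    linarith
  · intro ha
    refine ⟨hf, hf.memLp, ?_⟩
    filter_upwards [hsymb hf.memLp] with ξ h1 hξ
    rw [h1, waveSymbol, indicator_of_notMem]
    rw [mem_Ioi, not_lt]
    exact hξ.le.trans (by positivity)

end WaveSymbol

/-! ### From traveling waves to profiles -/

lemma ae_eq_comp_sub {f g : ℝ → ℂ} (h : f =ᵐ[volume] g) (a : ℝ) :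
    (fun x => f (x - a)) =ᵐ[volume] fun x => g (x - a) :=
  (measurePreserving_sub_right volume a).quasiMeasurePreserving.ae_eq_comp h

lemma IsWeakDeriv.add {f g f' g' : ℝ → ℂ} (hf : LocallyIntegrable f volume)
    (hg : LocallyIntegrable g volume) (hf' : LocallyIntegrable f' volume)
    (hg' : LocallyIntegrable g' volume) (h : IsWeakDeriv f g) (h' : IsWeakDeriv f' g') :
    IsWeakDeriv (fun x => f x + f' x) (fun x => g x + g' x) := by
  intro φ hφ hs
  have hd := contDiff_deriv hφ
  simp only [add_mul]
  rw [integral_add (integrable_mul_of_compactSupport hf hd.continuous hs.deriv)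
    (integrable_mul_of_compactSupport hf' hd.continuous hs.deriv), h φ hφ hs, h' φ hφ hs,
    integral_add (integrable_mul_of_compactSupport hg hφ.continuous hs)
    (integrable_mul_of_compactSupport hg' hφ.continuous hs)]
  ring

/-- `R` is only locally integrable, so the derivative falls on `φ`: the integral is a convolution
with the reflected test function. -/
lemma hasDerivAt_integral_mul_comp_add {R φ : ℝ → ℂ} (hR : LocallyIntegrable R volume)
    (hφ : ContDiff ℝ (⊤ : ℕ∞) φ) (hs : HasCompactSupport φ) (v t : ℝ) :
    HasDerivAt (fun s : ℝ => ∫ x, R x * φ (x + v * s))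
      (v * ∫ x, R x * deriv φ (x + v * t)) t := by
  have hψ : ContDiff ℝ 1 fun x => φ (-x) :=
    (hφ.comp contDiff_neg).of_le (by exact_mod_cast le_top)
  have hψs : HasCompactSupport fun x => φ (-x) :=
    hs.comp_homeomorph (Homeomorph.neg ℝ)
  have h1 := hψs.hasDerivAt_convolution_right (ContinuousLinearMap.mul ℝ ℂ) hR hψ (-(v * t))
  have h2 : HasDerivAt (fun s : ℝ => -(v * s)) (-v) t := by
    simpa using! ((hasDerivAt_id t).const_mul v).neg
  have h3 := h1.scomp t h2
  refine (h3.congr_of_eventuallyEq (Eventually.of_forall fun s => ?_)).congr_deriv ?_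
  · simp only [Function.comp_apply, convolution_def, ContinuousLinearMap.mul_apply']
    congr 1
    ext x
    congr 2
    ring
  · simp only [convolution_def, ContinuousLinearMap.mul_apply', deriv_comp_neg]
    rw [neg_smul, ← smul_neg, ← integral_neg, Complex.real_smul]
    congr 2
    ext x
    rw [mul_neg, neg_neg]
    congr 2
    ring

lemma uniqueDiffWithinAt_of_ordConnected {J : Set ℝ} (hJ : J.OrdConnected) (hJ' : J.Nontrivial)
    {t : ℝ} (ht : t ∈ J) : UniqueDiffWithinAt ℝ J t := by
  obtain ⟨a, ha, b, hb, hab⟩ := hJ'.exists_lt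
  refine uniqueDiffWithinAt_convex hJ.convex ⟨(a + b) / 2, ?_⟩ (subset_closure ht)
  have h1 : Ioo a b ⊆ J := Ioo_subset_Icc_self.trans (hJ.out ha hb)
  exact interior_maximal h1 isOpen_Ioo ⟨by linarith, by linarith⟩

namespace IsTravelingWave

variable {J : Set ℝ} {v ω : ℝ} {R : ℝ → ℂ} {u : ℝ → ℝ → ℂ}

/-- The equation for a traveling wave, at a fixed time. -/
lemma stationary_equation (h : IsTravelingWave J v ω R u) (hJ : J.OrdConnected)
    (hJ' : J.Nontrivial) {t : ℝ} (ht : t ∈ J) {φ : ℝ → ℂ} (hφ : ContDiff ℝ (⊤ : ℕ∞) φ)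
    (hs : HasCompactSupport φ) :
    Complex.I * ω * (∫ x, u t x * φ x) + v * ∫ x, u t x * deriv φ x =
      Complex.I * (∫ x, u t x * iteratedDeriv 2 φ x) +
        Complex.I * ∫ x, DAddAbsD (fun z => ((‖u t z‖ ^ 2 : ℝ) : ℂ)) x * u t x * φ x := by
  have e : ∀ s ∈ J, ∀ χ : ℝ → ℂ, ∫ x, u s x * χ x =
      Complex.exp (Complex.I * ω * s) * ∫ x, R x * χ (x + v * s) := by
    intro s hsJ χ
    rw [← integral_const_mul]
    have h1 : ∫ x, u s x * χ x =
        ∫ x, Complex.exp (Complex.I * ω * s) * (R (x - v * s) * χ (x - v * s + v * s)) := by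
      refine integral_congr_ae ((h.form s hsJ).mono fun x hx => ?_)
      simp only
      rw [hx, sub_add_cancel]
      ring
    rw [h1]
    exact integral_sub_right_eq_self
      (fun x => Complex.exp (Complex.I * ω * s) * (R x * χ (x + v * s))) (v * s)
  have hR := h.profile_memH1.memLp.locallyIntegrable one_le_two
  have hexp : HasDerivAt (fun s : ℝ => Complex.exp (Complex.I * ω * s))
      (Complex.I * ω * Complex.exp (Complex.I * ω * t)) t := by
    have := ((hasDerivAt_id (t : ℂ)).const_mul (Complex.I * ω)).cexp.comp_ofReal
    simpa [mul_comm] using this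
  have hd := (hexp.mul (hasDerivAt_integral_mul_comp_add hR hφ hs v t)).hasDerivWithinAt (s := J)
  have hd' : HasDerivWithinAt (fun s : ℝ => ∫ x, u s x * φ x) _ J t :=
    hd.congr (fun s hsJ => e s hsJ φ) (e t ht φ)
  -- Derivatives within a nontrivial interval are unique, end points included, so the derivative
  -- from the travelling form equals the one from the equation.
  have := (uniqueDiffWithinAt_of_ordConnected hJ hJ' ht).eq_deriv _ hd'
    (h.solution.equation t ht φ hφ hs)
  rw [← this, e t ht φ, e t ht (deriv φ)]
  ring

lemma profile_ae_eq (h : IsTravelingWave J v ω R u) {t : ℝ} (ht : t ∈ J) :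
    R =ᵐ[volume] fun x => Complex.exp (-(Complex.I * ω * t)) * u t (x + v * t) := by
  have h1 := ae_eq_comp_sub (h.form t ht) (-(v * t))
  filter_upwards [h1] with x hx
  simp only [sub_neg_eq_add, add_sub_cancel_right] at hx
  rw [hx, ← mul_assoc, ← Complex.exp_add, neg_add_cancel, Complex.exp_zero, one_mul]

/-- The modulated wave solves the profile equation. -/
lemma exists_isProfile (h : IsTravelingWave J v ω R u) (hJ : J.OrdConnected)
    (hJ' : J.Nontrivial) {t : ℝ} (ht : t ∈ J) :
    ∃ Q q, (u t =ᵐ[volume] fun x => Complex.exp (Complex.I / 2 * v * x) * Q x) ∧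
      IsProfile (ω - v ^ 2 / 4) Q q := by
  have hU := h.solution.memH1 t ht
  set U := u t with hUdef
  obtain ⟨g, hg, hUg⟩ := hU.exists_isWeakDeriv
  have hUL := hU.memLp
  set N : ℝ → ℂ := fun x => DAddAbsD (fun z => ((‖U z‖ ^ 2 : ℝ) : ℂ)) x with hN
  have hNL : MemLp N 2 volume := Lp.memLp _
  have lU := hUL.locallyIntegrable one_le_two
  have lg := hg.locallyIntegrable one_le_two
  have lNU := (integrable_mul_of_memLp hNL hUL).locallyIntegrable
  have lωU : LocallyIntegrable (fun x => ω * U x) volume :=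
    (hUL.const_mul (ω : ℂ)).locallyIntegrable one_le_two
  have lvg : LocallyIntegrable (fun x => Complex.I * v * g x) volume :=
    (hg.const_mul (Complex.I * v)).locallyIntegrable one_le_two
  have lk : LocallyIntegrable (fun x => ω * U x + Complex.I * v * g x - N x * U x) volume :=
    (lωU.add lvg).sub lNU
  -- The equation reads `U'' = ω U + iv U' - N U`. The modulation `e` below removes the first order
  -- term, turns `ω` into `ω - v²/4` and leaves `|U|²` unchanged.
  have hgk : IsWeakDeriv g (fun x => ω * U x + Complex.I * v * g x - N x * U x) := by
    intro φ hφ hs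
    have hd := contDiff_deriv hφ
    have h1 := h.stationary_equation hJ hJ' ht hφ hs
    have h2 := hUg _ hd hs.deriv
    have h3 := hUg φ hφ hs
    have e2 : iteratedDeriv 2 φ = deriv (deriv φ) := by
      rw [iteratedDeriv_succ, iteratedDeriv_one]
    rw [e2, ← hUdef, h2, h3] at h1
    have i1 := integrable_mul_of_compactSupport lωU hφ.continuous hs
    have i2 := integrable_mul_of_compactSupport lvg hφ.continuous hs
    have i3 := integrable_mul_of_compactSupport lNU hφ.continuous hs
    simp only [sub_mul, add_mul]
    have i12 : Integrable fun x => ω * U x * φ x + Complex.I * v * g x * φ x := i1.add i2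
    rw [integral_sub i12 i3, integral_add i1 i2]
    simp only [mul_assoc, integral_const_mul] at h1 ⊢
    simp only [hN]
    linear_combination (-Complex.I) * h1 + (ω * (∫ x, U x * φ x) + (∫ x, g x * deriv φ x) -
      ∫ x, DAddAbsD (fun z => ((‖U z‖ ^ 2 : ℝ) : ℂ)) x * (U x * φ x)) * Complex.I_sq
  set e : ℝ → ℂ := fun x => Complex.exp (-(Complex.I / 2 * v) * x) with he
  have hed : ∀ x : ℝ, HasDerivAt e (-(Complex.I / 2 * v) * e x) x := by
    intro x
    have := ((hasDerivAt_id (x : ℂ)).const_mul (-(Complex.I / 2 * v))).cexp.comp_ofReal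
    simpa [mul_comm, he] using this
  have hde : deriv e = fun x => -(Complex.I / 2 * v) * e x := funext fun x => (hed x).deriv
  have hes : ContDiff ℝ (⊤ : ℕ∞) e := by
    have : ContDiff ℝ (⊤ : ℕ∞) fun x : ℝ => (x : ℂ) := Complex.ofRealCLM.contDiff
    exact (contDiff_const.mul this).cexp
  have hdes : ContDiff ℝ (⊤ : ℕ∞) (deriv e) := contDiff_deriv hes
  have hdde : deriv (deriv e) = fun x => -(Complex.I / 2 * v) * (-(Complex.I / 2 * v) * e x) := by
    ext x
    rw [hde]
    exact ((hed x).const_mul _).deriv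
  have hnorm : ∀ x, ‖e x‖ = 1 := by
    intro x
    rw [he, Complex.norm_exp]
    simp
  have hmeas := hes.continuous.aestronglyMeasurable (μ := volume)
  have hmul : ∀ {f : ℝ → ℂ} {E : ℝ → ℂ}, LocallyIntegrable f volume → Continuous E →
      LocallyIntegrable (fun x => E x * f x) volume := by
    intro f E hf hE
    have := (hf.locallyIntegrableOn univ).continuousOn_mul hE.continuousOn
      isOpen_univ.isLocallyClosed
    exact locallyIntegrableOn_univ.1 this
  have w1 := hUg.smooth_mul lU lg hes
  have w2 := hUg.smooth_mul lU lg hdes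
  have w3 := hgk.smooth_mul lg lk hes
  have w4 := w2.add (hmul lU hdes.continuous)
    ((hmul lU (contDiff_deriv hdes).continuous).add (hmul lg hdes.continuous))
    (hmul lg hes.continuous) ((hmul lg hdes.continuous).add (hmul lk hes.continuous)) w3
  have hfL : MemLp (fun x => e x * U x) 2 volume :=
    memLp_bdd_mul hUL hmeas fun x => (hnorm x).le
  have hqL : MemLp (fun x => deriv e x * U x + e x * g x) 2 volume := by
    refine MemLp.add ?_ (memLp_bdd_mul hg hmeas fun x => (hnorm x).le)
    refine (memLp_congr_ae (ae_of_all _ fun x => ?_)).1 (hfL.const_mul (-(Complex.I / 2 * v)))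
    simp only [hde]
    ring
  have hdens : (fun z => ((‖e z * U z‖ ^ 2 : ℝ) : ℂ)) = fun z => ((‖U z‖ ^ 2 : ℝ) : ℂ) := by
    ext z
    rw [norm_mul, hnorm, one_mul]
  obtain ⟨Q, q, hQ, hP⟩ := CMDNLS.exists_isProfile (μ := ω - v ^ 2 / 4) hfL hqL w1 (by
    rw [hdens]
    refine cast (congrArg _ (funext fun x => ?_)) w4
    simp only [Pi.add_apply, hdde]
    simp only [hde, hN]
    push_cast
    linear_combination ((v : ℂ) ^ 2 / 4 * e x * U x) * Complex.I_sq)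
  refine ⟨Q, q, ?_, hP⟩
  filter_upwards [hQ] with x hx
  rw [← hx, he, ← mul_assoc, ← Complex.exp_add]
  have : Complex.I / 2 * v * x + -(Complex.I / 2 * v) * x = 0 := by ring
  rw [this, Complex.exp_zero, one_mul]

/-- Classification of the profiles of traveling waves. -/
theorem exists_profile_eq (h : IsTravelingWave J v ω R u) (hJ : J.OrdConnected)
    (hJ' : J.Nontrivial) :
    ω = v ^ 2 / 4 ∧ ∃ κ c : ℂ, 0 < c.im ∧ ‖κ‖ ^ 2 = 2 * c.im ∧
      R =ᵐ[volume] fun x => Complex.exp (Complex.I / 2 * v * x) * (κ / (x + c)) := by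
  obtain ⟨t, ht⟩ := hJ'.nonempty
  obtain ⟨Q, q, hQ, hP⟩ := h.exists_isProfile hJ hJ' ht
  have hRu : R =ᵐ[volume] fun x => Complex.exp (-(Complex.I * ω * t)) *
      (Complex.exp (Complex.I / 2 * v * ((x + v * t : ℝ) : ℂ)) * Q (x + v * t)) := by
    have h1 := ae_eq_comp_sub hQ (-(v * t))
    filter_upwards [h1, h.profile_ae_eq ht] with x hx hx'
    rw [hx']
    simp only [sub_neg_eq_add] at hx
    rw [hx]
  obtain ⟨x₀, hx₀⟩ : ∃ x₀, Q x₀ ≠ 0 := by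
    by_contra hcon
    push Not at hcon
    refine h.profile_ne_zero ?_
    filter_upwards [hRu] with x hx
    rw [hx, hcon, mul_zero, mul_zero, Pi.zero_apply]
  obtain ⟨hμ, κ, c, hc, hκ, hQe⟩ := hP.exists_eq_div hx₀
  have hω : ω = v ^ 2 / 4 := sub_eq_zero.1 hμ
  -- The profile is recovered from time `t`: `c` absorbs the translation `vt`, and `κ` the phase
  -- `-ωt + v²t/2 = v²t/4`.
  refine ⟨hω, Complex.exp (((v ^ 2 / 4 * t : ℝ) : ℂ) * Complex.I) * κ, c + (v * t : ℝ), ?_, ?_, ?_⟩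
  · rw [Complex.add_im, Complex.ofReal_im, add_zero]
    exact hc
  · rw [norm_mul, Complex.norm_exp_ofReal_mul_I, one_mul, hκ, Complex.add_im, Complex.ofReal_im,
      add_zero]
  · filter_upwards [hRu] with x hx
    rw [hx, hQe, hω]
    have e1 : Complex.exp (-(Complex.I * ((v ^ 2 / 4 : ℝ) : ℂ) * t)) *
        Complex.exp (Complex.I / 2 * v * ((x + v * t : ℝ) : ℂ)) =
        Complex.exp (Complex.I / 2 * v * x) *
          Complex.exp (((v ^ 2 / 4 * t : ℝ) : ℂ) * Complex.I) := by
      rw [← Complex.exp_add, ← Complex.exp_add]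
      congr 1
      push_cast
      ring
    have e2 : ((x + v * t : ℝ) : ℂ) + c = x + (c + (v * t : ℝ)) := by
      push_cast
      ring
    rw [← mul_assoc, e1, e2]
    ring

end IsTravelingWave

end CMDNLS

theorem theorem1p2 (J : Set ℝ) (hJ : J.OrdConnected) (hJ' : J.Nontrivial) :
    -- every traveling solitary wave with a nonzero `H¹` profile
    (∀ (v ω : ℝ) (R : ℝ → ℂ) (u : ℝ → ℝ → ℂ), CMDNLS.IsTravelingWave J v ω R u →
      ω = v ^ 2 / 4 ∧
      (∃ θ ∈ Ico (0 : ℝ) (2 * Real.pi), ∃ lam : ℝ, 0 < lam ∧ ∃ y : ℝ,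
        R =ᵐ[volume] fun x : ℝ =>
          Complex.exp (Complex.I / 2 * v * x) * Complex.exp (Complex.I * θ) *
            (Real.sqrt lam : ℂ) * CMDNLS.groundState (lam * x + y)) ∧
      (CMDNLS.MemH1Plus R ↔ 0 ≤ v) ∧
      (∀ t ∈ J, CMDNLS.mass (u t) = CMDNLS.mass CMDNLS.groundState)) ∧
    -- every traveling solitary wave in `H¹₊`
    (∀ u : ℝ → ℝ → ℂ,
      (∃ (v ω : ℝ) (R : ℝ → ℂ), CMDNLS.IsTravelingWave J v ω R u) →
      (∀ t ∈ J, CMDNLS.MemH1Plus (u t)) →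
      (∃ θ ∈ Ico (0 : ℝ) (2 * Real.pi), ∃ y : ℝ, ∃ lam : ℝ, 0 < lam ∧ ∃ η : ℝ, 0 ≤ η ∧
        ∀ t ∈ J, u t =ᵐ[volume] fun x : ℝ =>
          Complex.exp (Complex.I * θ + Complex.I * η * x - Complex.I * η ^ 2 * t) *
            (Real.sqrt lam : ℂ) * CMDNLS.groundState (lam * (x - 2 * η * t) + y)) ∧
      (∀ t ∈ J, CMDNLS.mass (u t) = CMDNLS.mass CMDNLS.groundState)) ∧
    -- the critical mass
    CMDNLS.mass CMDNLS.groundState = 2 * Real.pi := by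
  have hne : ∀ {κ c : ℂ}, 0 < c.im → ‖κ‖ ^ 2 = 2 * c.im → κ ≠ 0 := by
    rintro κ c hc hκ rfl
    rw [norm_zero] at hκ
    linarith
  have hmass : ∀ (v ω : ℝ) (R : ℝ → ℂ) (u : ℝ → ℝ → ℂ), CMDNLS.IsTravelingWave J v ω R u →
      ∀ t ∈ J, CMDNLS.mass (u t) = CMDNLS.mass CMDNLS.groundState := by
    intro v ω R u h t ht
    obtain ⟨hω, κ, c, hc, hκ, hR⟩ := h.exists_profile_eq hJ hJ'
    refine CMDNLS.mass_eq_of_ae_eq (c := c - (v * t : ℝ)) (κ := κ)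
      (e := fun x : ℝ => Complex.exp (((ω * t + v / 2 * (x - v * t) : ℝ) : ℂ) * Complex.I))
      (by simpa using hc) (by simpa using hκ) (fun x => Complex.norm_exp_ofReal_mul_I _) ?_
    filter_upwards [h.form t ht, CMDNLS.ae_eq_comp_sub hR (v * t)] with x h1 h2
    rw [h1, h2, ← mul_assoc, ← Complex.exp_add]
    congr 2
    · push_cast
      ring
    · push_cast
      ring
  refine ⟨fun v ω R u h => ?_, fun u ⟨v, ω, R, h⟩ hplus => ?_, CMDNLS.mass_groundState⟩
  · obtain ⟨hω, κ, c, hc, hκ, hR⟩ := h.exists_profile_eq hJ hJ'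
    refine ⟨hω, ?_, ?_, hmass v ω R u h⟩
    · obtain ⟨θ, hθ, lam, hlam, y, he⟩ := CMDNLS.exists_eq_groundState hc hκ
      refine ⟨θ, hθ, lam, hlam, y, ?_⟩
      filter_upwards [hR] with x hx
      rw [hx, he]
      ring
    · rw [CMDNLS.memH1Plus_iff (a := v / 2) h.profile_memH1 hc (hne hc hκ)]
      · exact ⟨fun h0 => by linarith, fun h0 => by linarith⟩
      · filter_upwards [hR] with x hx
        rw [hx]
        congr 2
        push_cast
        ring
  · obtain ⟨hω, κ, c, hc, hκ, hR⟩ := h.exists_profile_eq hJ hJ'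
    -- One time suffices: translation and constant phase only alter `c` by a real number and `κ` by
    -- a unit factor, not the frequency threshold.
    have hv : 0 ≤ v := by
      obtain ⟨t, ht⟩ := hJ'.nonempty
      have h0 := (CMDNLS.memH1Plus_iff (a := v / 2) (c := c - (v * t : ℝ))
        (κ := Complex.exp (Complex.I * ω * t - Complex.I / 2 * v * (v * t)) * κ)
        (h.solution.memH1 t ht) (by simpa using hc)
        (mul_ne_zero (Complex.exp_ne_zero _) (hne hc hκ)) ?_).1 (hplus t ht)
      · linarith
      · filter_upwards [h.form t ht, CMDNLS.ae_eq_comp_sub hR (v * t)] with x h1 h2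
        have e1 : Complex.exp (Complex.I * ω * t) *
            Complex.exp (Complex.I / 2 * v * ((x - v * t : ℝ) : ℂ)) =
            Complex.exp (Complex.I * ((v / 2 : ℝ) : ℂ) * x) *
              Complex.exp (Complex.I * ω * t - Complex.I / 2 * v * (v * t)) := by
          rw [← Complex.exp_add, ← Complex.exp_add]
          congr 1
          push_cast
          ring
        have e2 : ((x - v * t : ℝ) : ℂ) + c = x + (c - (v * t : ℝ)) := by
          push_cast
          ring
        rw [h1, h2, ← mul_assoc, e1, e2]
        ring
    refine ⟨?_, hmass v ω R u h⟩
    obtain ⟨θ, hθ, lam, hlam, y, he⟩ := CMDNLS.exists_eq_groundState hc hκ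
    -- With `η = v/2` the velocity is `2η` and `ω = η²`; the translated phase `η(x - 2ηt)` plus
    -- `η²t` gives `ηx - η²t`.
    refine ⟨θ, hθ, y, lam, hlam, v / 2, by linarith, fun t ht => ?_⟩
    filter_upwards [h.form t ht, CMDNLS.ae_eq_comp_sub hR (v * t)] with x h1 h2
    rw [h1, h2, he, hω, ← mul_assoc, ← mul_assoc, ← mul_assoc, ← Complex.exp_add,
      ← Complex.exp_add]
    congr 2
    · congr 1
      push_cast
      ring
    · ring
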